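/- **EM update with missing returns.** Let $n,n_1,n_2,T\ge 0$ be integers and let $F_1\in\mathbb R^{n\times n_1}$ be a known matrix. A parameter is $\theta=(F_2,\Omega,D)$ with $F_2\in\mathbb R^{n\times n_2}$ arbitrary, $\Omega\in\mathbb R^{n_1\times n_1}$ positive definite and $D\in\mathbb R^{n\times n}$ diagonal with positive diagonal entries. Put $\tilde F=[F_1\ F_2]$ and $\tilde\Omega=\begin{bmatrix}\Omega&0\\0&I\end{bmatrix}$. Under $\theta$, $S\sim\mathcal N(0,\tilde\Omega)$ and $E\sim\mathcal N(0,D)$ are independent and $X=\tilde FS+E$; the pair $(X,S)$ then has joint density $p_\theta(x,s)=\mathcal N(x;\tilde Fs,D)\,\mathcal N(s;0,\tilde\Omega)$. Let $w_1,\dots,w_T\ge 0$ with $\sum_\tau w_\tau=1$. At time $\tau$ only the coordinates in $\mathcal O_\tau\subseteq\{1,\dots,n\}$ are observed, with value $x_{\tau,\mathrm{obs}}$; $\mathcal M_\tau$ is the complement of $\mathcal O_\tau$. The subscripts "obs" and "mis" denote restriction of vectors and of rows (for $D$: rows and columns) to $\mathcal O_\tau$ and $\mathcal M_\tau$, and $\Pi_\tau$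 is the permutation matrix with $\Pi_\tau v=\begin{bmatrix}v_{\mathrm{mis}}\\v_{\mathrm{obs}}\end{bmatrix}$. Let $\theta_k=(F_{2,k},\Omega_k,D_k)$ be a parameter, let $q_\tau(s,x_{\mathrm{mis}})=p_{\theta_k}(x,s)/\int p_{\theta_k}(x,s)\,dx_{\mathrm{mis}}\,ds$ with $x=\Pi_\tau^\top\begin{bmatrix}x_{\mathrm{mis}}\\x_{\tau,\mathrm{obs}}\end{bmatrix}$ be the conditional density of $(S_\tau,X_{\tau,\mathrm{mis}})$ given $X_{\tau,\mathrm{obs}}=x_{\tau,\mathrm{obs}}$ under $\theta_k$, and write $\mathbb E_\tau[\cdot]=\mathbb E[\,\cdot\mid X_{\tau,\mathrm{obs}}=x_{\tau,\mathrm{obs}};\theta_k]$ for the expectation under $q_\tau$. Define $$G_{k,\tau}=\big(\tilde F_{k,\tau,\mathrm{obs}}^\top D_{k,\tau,\mathrm{obs}}^{-1}\tilde F_{k,\tau,\mathrm{obs}}+\tilde\Omega_k^{-1}\big)^{-1},\quad L_{k,\tau}=G_{k,\tau}\tilde F_{k,\tau,\mathrm{obs}}^\top D_{k,\tau,\mathrm{obs}}^{-1},\quad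 \hat s_\tau=L_{k,\tau}x_{\tau,\mathrm{obs}},\quad \hat x_\tau=\Pi_\tau^\top\begin{bmatrix}\tilde F_{k,\tau,\mathrm{mis}}\hat s_\tau\\x_{\tau,\mathrm{obs}}\end{bmatrix}.$$ **E-step.** The measure with density $q_\tau$ is a version of the regular conditional distribution of $(X_{\tau,\mathrm{mis}},S_\tau)$ given $X_{\tau,\mathrm{obs}}$ and is a probability measure. For every $\tau$, $G_{k,\tau}$ is positive definite, $S_\tau\mid X_{\tau,\mathrm{obs}}=x_{\tau,\mathrm{obs}};\theta_k\sim\mathcal N(\hat s_\tau,G_{k,\tau})$, the second moments below exist, and $$\mathbb E_\tau[S_\tau S_\tau^\top]=G_{k,\tau}+\hat s_\tau\hat s_\tau^\top,\qquad \mathbb E_\tau[X_\tau S_\tau^\top]=\hat x_\tau\hat s_\tau^\top+\Pi_\tau^\top\begin{bmatrix}\tilde F_{k,\tau,\mathrm{mis}}G_{k,\tau}\\0\end{bmatrix},$$ $$\mathbb E_\tau[X_\tau X_\tau^\top]=\hat x_\tau\hat x_\tau^\top+\Pi_\tau^\top\begin{bmatrix}\tilde F_{k,\tau,\mathrm{mis}}G_{k,\tau}\tilde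 F_{k,\tau,\mathrm{mis}}^\top+D_{k,\tau,\mathrm{mis}}&0\\0&0\end{bmatrix}\Pi_\tau.$$ **M-step.** Let $C_{xx}^k=\sum_\tau w_\tau\mathbb E_\tau[X_\tau X_\tau^\top]$, $W_{xs}^k=\sum_\tau w_\tau\mathbb E_\tau[X_\tau S_\tau^\top]=[W_{xs,1}^k\ W_{xs,2}^k]$ and $C_{ss}^k=\sum_\tau w_\tau\mathbb E_\tau[S_\tau S_\tau^\top]$ with blocks $C^k_{ss,ij}$, $i,j\in\{1,2\}$, and let $$\tilde\Sigma_k=C_{xx}^k+F_1C_{ss,11}^kF_1^\top-2W_{xs,1}^kF_1^\top,\qquad \tilde C_{xs}^k=W_{xs,2}^k-F_1C_{ss,12}^k.$$ For every parameter $\theta$ the expectations $\mathbb E_\tau[-2\log p_\theta(X_\tau,S_\tau)]$ exist, and, up to an additive constant that does not depend on $\theta$, the objective $J_k(\theta)=\sum_\tau w_\tau\mathbb E_\tau[-2\log p_\theta(X_\tau,S_\tau)]$ equals $$\operatorname{tr}\!\big(D^{-1}(\tilde\Sigma_k-2\tilde C_{xs}^kF_2^\top+F_2C_{ss,22}^kF_2^\top)\big)+\log\det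 D+\operatorname{tr}(\Omega^{-1}C_{ss,11}^k)+\log\det\Omega.$$ The matrix $C_{ss,22}^k$ is positive definite, and a parameter $\theta=(F_2,\Omega,D)$ minimizes $J_k$ over all parameters if and only if $$\Omega=C_{ss,11}^k,\qquad F_2=\tilde C_{xs}^k(C_{ss,22}^k)^{-1},\qquad D=\operatorname{diag}\!\big(\tilde\Sigma_k-\tilde C_{xs}^k(C_{ss,22}^k)^{-1}(\tilde C_{xs}^k)^\top\big).$$ The triple defined by these three formulas is a parameter (that is, the diagonal entries of $D$ are positive), and hence is the unique minimizer, if and only if for every asset $i$ the $i$-th row of $F_1$ is nonzero, or there is a $\tau$ with $w_\tau>0$ such that $i\in\mathcal M_\tau$ or the observed return of asset $i$ at time $\tau$ is nonzero. **Relation to the fully observed case.** If every $\mathcal O_\tau$ is $\{1,\dots,n\}$ and the observed returns are $x_\tau$, then with $C=\sum_\tau w_\tau x_\tau x_\tau^\top$, $G_k=(\tilde F_k^\top D_k^{-1}\tilde F_k+\tilde\Omega_k^{-1})^{-1}$ and $L_k=G_k\tilde F_k^\top D_k^{-1}$ one has $C_{xx}^k=C$, $W_{xs}^k=CL_k^\top=:C_{xs}^k$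 and $C_{ss}^k=G_k+L_kCL_k^\top$. So the M-step above is the fully observed one with $C$ and $C_{xs}^k$ replaced by $C_{xx}^k$ and $W_{xs}^k$, and with $C_{ss}^k$ the aggregated conditional second moment of $S$. -/

import Mathlib

open MeasureTheory ProbabilityTheory Matrix

namespace FactorEM

noncomputable section

/-- The density at `x` of the nondegenerate Gaussian distribution with mean `μ` and (positive
definite) covariance matrix `V`, with respect to Lebesgue measure on `ι → ℝ`. -/
def gaussianDensity {ι : Type} [Fintype ι] [DecidableEq ι]
    (μ : ι → ℝ) (V : Matrix ι ι ℝ) (x : ι → ℝ) : ℝ :=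
  (Real.sqrt ((2 * Real.pi) ^ Fintype.card ι * V.det))⁻¹ *
    Real.exp (-(1 / 2) * ((x - μ) ⬝ᵥ (V⁻¹ *ᵥ (x - μ))))

/-- The Gaussian law with mean `μ` and covariance matrix `V`, as a measure on `ι → ℝ`. -/
def gaussianLaw {ι : Type} [Fintype ι] [DecidableEq ι]
    (μ : ι → ℝ) (V : Matrix ι ι ℝ) : Measure (ι → ℝ) :=
  (multivariateGaussian (WithLp.toLp 2 μ) V).map WithLp.ofLp

instance {ι : Type} [Fintype ι] [DecidableEq ι] (μ : ι → ℝ) (V : Matrix ι ι ℝ) :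
    IsProbabilityMeasure (gaussianLaw μ V) := by
  unfold gaussianLaw
  exact Measure.isProbabilityMeasure_map (by fun_prop)

/-- The parameter `θ = (F₂, Ω, D)` of the extended factor model: `n` assets, `n₁` base factors with
known exposures and `n₂` added factors. -/
@[ext]
structure Params (n n₁ n₂ : ℕ) where
  F₂ : Matrix (Fin n) (Fin n₂) ℝ
  Ω : Matrix (Fin n₁) (Fin n₁) ℝ
  D : Matrix (Fin n) (Fin n) ℝ

variable {n n₁ n₂ T : ℕ}

/-- The constraints on `θ`: `Ω` is positive definite and `D` is diagonal with positive diagonal. -/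
def Params.Feasible (θ : Params n n₁ n₂) : Prop :=
  θ.Ω.PosDef ∧ θ.D.IsDiag ∧ ∀ i, 0 < θ.D i i

/-- `F̃ = [F₁ F₂]`. -/
def Params.Ftilde (F₁ : Matrix (Fin n) (Fin n₁) ℝ) (θ : Params n n₁ n₂) :
    Matrix (Fin n) (Fin n₁ ⊕ Fin n₂) ℝ :=
  Matrix.fromCols F₁ θ.F₂

/-- `Ω̃ = [Ω 0; 0 I]`. -/
def Params.Otilde (θ : Params n n₁ n₂) : Matrix (Fin n₁ ⊕ Fin n₂) (Fin n₁ ⊕ Fin n₂) ℝ :=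
  Matrix.fromBlocks θ.Ω 0 0 1

/-- The law of `(X, S)`, where `S ∼ N(0, Ω̃)` and `E ∼ N(0, D)` are independent and
`X = F̃ S + E`. -/
def modelLaw (F₁ : Matrix (Fin n) (Fin n₁) ℝ) (θ : Params n n₁ n₂) :
    Measure ((Fin n → ℝ) × (Fin n₁ ⊕ Fin n₂ → ℝ)) :=
  ((gaussianLaw 0 θ.Otilde).prod (gaussianLaw 0 θ.D)).map
    (fun z => (θ.Ftilde F₁ *ᵥ z.1 + z.2, z.1))

instance (F₁ : Matrix (Fin n) (Fin n₁) ℝ) (θ : Params n n₁ n₂) :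
    IsProbabilityMeasure (modelLaw F₁ θ) := by
  unfold modelLaw
  exact Measure.isProbabilityMeasure_map (by fun_prop)

/-- The joint density `p_θ(x, s)`: `s ∼ N(0, Ω̃)` and `x | s ∼ N(F̃ s, D)`. -/
def jointDensity (F₁ : Matrix (Fin n) (Fin n₁) ℝ) (θ : Params n n₁ n₂)
    (x : Fin n → ℝ) (s : Fin n₁ ⊕ Fin n₂ → ℝ) : ℝ :=
  gaussianDensity (θ.Ftilde F₁ *ᵥ s) θ.D x * gaussianDensity 0 θ.Otilde s

/-- The permutation matrix `Π` with `[v_mis; v_obs] = Π v`, when the coordinates in `O` are the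
observed ones. -/
def permMatrix (O : Finset (Fin n)) :
    Matrix ({i // i ∉ O} ⊕ {i // i ∈ O}) (Fin n) ℝ :=
  Matrix.of fun a i => if Sum.elim Subtype.val Subtype.val a = i then 1 else 0

/-- The full vector `Πᵀ [v_mis; v_obs]`. -/
def merge (O : Finset (Fin n)) (vmis : {i // i ∉ O} → ℝ) (vobs : {i // i ∈ O} → ℝ) :
    Fin n → ℝ :=
  (permMatrix O)ᵀ *ᵥ Sum.elim vmis vobs

theorem merge_apply (O : Finset (Fin n)) (vmis : {i // i ∉ O} → ℝ) (vobs : {i // i ∈ O} → ℝ)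
    (i : Fin n) :
    merge O vmis vobs i = if h : i ∈ O then vobs ⟨i, h⟩ else vmis ⟨i, h⟩ := by
  unfold merge permMatrix
  simp only [Matrix.mulVec, dotProduct, Matrix.transpose_apply, Matrix.of_apply,
    Fintype.sum_sum_type, Sum.elim_inl, Sum.elim_inr, ite_mul, one_mul, zero_mul]
  by_cases h : i ∈ O
  · have h1 : ∀ a : {i // i ∉ O}, (a : Fin n) ≠ i := fun a ha => a.2 (ha ▸ h)
    rw [Finset.sum_eq_single (⟨i, h⟩ : {i // i ∈ O})]
    · simp [h, h1]
    · intro b _ hb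
      exact if_neg fun hbi => hb (Subtype.ext hbi)
    · simp
  · have h1 : ∀ a : {i // i ∈ O}, (a : Fin n) ≠ i := fun a ha => h (ha ▸ a.2)
    rw [Finset.sum_eq_single (⟨i, h⟩ : {i // i ∉ O})]
    · simp [h, h1]
    · intro b _ hb
      exact if_neg fun hbi => hb (Subtype.ext hbi)
    · simp

/-- The latent variables `(x_mis, s)`. -/
abbrev Latent (n₁ n₂ : ℕ) (O : Finset (Fin n)) : Type :=
  ({i // i ∉ O} → ℝ) × (Fin n₁ ⊕ Fin n₂ → ℝ)

/-- The marginal density of the observed returns, `∫ p_θ(x, s) dx_mis ds`. -/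
def obsDensity (F₁ : Matrix (Fin n) (Fin n₁) ℝ) (θ : Params n n₁ n₂) (O : Finset (Fin n))
    (xobs : {i // i ∈ O} → ℝ) : ℝ :=
  ∫ z : Latent n₁ n₂ O, jointDensity F₁ θ (merge O z.1 xobs) z.2

/-- The conditional law of `(X_mis, S)` given `X_obs = x_obs`: the measure with density
`p_θ(x, s) / p_{θ,obs}(x_obs)` with respect to Lebesgue measure `dx_mis ds`. -/
def condLaw (F₁ : Matrix (Fin n) (Fin n₁) ℝ) (θ : Params n n₁ n₂) (O : Finset (Fin n))
    (xobs : {i // i ∈ O} → ℝ) : Measure (Latent n₁ n₂ O) :=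
  volume.withDensity fun z =>
    ENNReal.ofReal (jointDensity F₁ θ (merge O z.1 xobs) z.2 / obsDensity F₁ θ O xobs)

/-- `E[S Sᵀ | X_obs = x_obs; θ]`. -/
def condSS (F₁ : Matrix (Fin n) (Fin n₁) ℝ) (θ : Params n n₁ n₂) (O : Finset (Fin n))
    (xobs : {i // i ∈ O} → ℝ) : Matrix (Fin n₁ ⊕ Fin n₂) (Fin n₁ ⊕ Fin n₂) ℝ :=
  Matrix.of fun a b => ∫ z, z.2 a * z.2 b ∂(condLaw F₁ θ O xobs)

/-- `E[X Sᵀ | X_obs = x_obs; θ]`. -/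
def condXS (F₁ : Matrix (Fin n) (Fin n₁) ℝ) (θ : Params n n₁ n₂) (O : Finset (Fin n))
    (xobs : {i // i ∈ O} → ℝ) : Matrix (Fin n) (Fin n₁ ⊕ Fin n₂) ℝ :=
  Matrix.of fun i b => ∫ z, merge O z.1 xobs i * z.2 b ∂(condLaw F₁ θ O xobs)

/-- `E[X Xᵀ | X_obs = x_obs; θ]`. -/
def condXX (F₁ : Matrix (Fin n) (Fin n₁) ℝ) (θ : Params n n₁ n₂) (O : Finset (Fin n))
    (xobs : {i // i ∈ O} → ℝ) : Matrix (Fin n) (Fin n) ℝ :=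
  Matrix.of fun i j => ∫ z, merge O z.1 xobs i * merge O z.1 xobs j ∂(condLaw F₁ θ O xobs)

/-- The rows of `F̃` indexed by the observed assets. -/
def Fobs (F₁ : Matrix (Fin n) (Fin n₁) ℝ) (θ : Params n n₁ n₂) (O : Finset (Fin n)) :
    Matrix {i // i ∈ O} (Fin n₁ ⊕ Fin n₂) ℝ :=
  (θ.Ftilde F₁).submatrix Subtype.val id

/-- The rows of `F̃` indexed by the missing assets. -/
def Fmis (F₁ : Matrix (Fin n) (Fin n₁) ℝ) (θ : Params n n₁ n₂) (O : Finset (Fin n)) :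
    Matrix {i // i ∉ O} (Fin n₁ ⊕ Fin n₂) ℝ :=
  (θ.Ftilde F₁).submatrix Subtype.val id

def Dobs (θ : Params n n₁ n₂) (O : Finset (Fin n)) : Matrix {i // i ∈ O} {i // i ∈ O} ℝ :=
  θ.D.submatrix Subtype.val Subtype.val

def Dmis (θ : Params n n₁ n₂) (O : Finset (Fin n)) : Matrix {i // i ∉ O} {i // i ∉ O} ℝ :=
  θ.D.submatrix Subtype.val Subtype.val

/-- `G = (F̃_obsᵀ D_obs⁻¹ F̃_obs + Ω̃⁻¹)⁻¹`. -/
def Gmat (F₁ : Matrix (Fin n) (Fin n₁) ℝ) (θ : Params n n₁ n₂) (O : Finset (Fin n)) :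
    Matrix (Fin n₁ ⊕ Fin n₂) (Fin n₁ ⊕ Fin n₂) ℝ :=
  ((Fobs F₁ θ O)ᵀ * (Dobs θ O)⁻¹ * Fobs F₁ θ O + θ.Otilde⁻¹)⁻¹

/-- `L = G F̃_obsᵀ D_obs⁻¹`. -/
def Lmat (F₁ : Matrix (Fin n) (Fin n₁) ℝ) (θ : Params n n₁ n₂) (O : Finset (Fin n)) :
    Matrix (Fin n₁ ⊕ Fin n₂) {i // i ∈ O} ℝ :=
  Gmat F₁ θ O * (Fobs F₁ θ O)ᵀ * (Dobs θ O)⁻¹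

/-- `ŝ = L x_obs`. -/
def shat (F₁ : Matrix (Fin n) (Fin n₁) ℝ) (θ : Params n n₁ n₂) (O : Finset (Fin n))
    (xobs : {i // i ∈ O} → ℝ) : Fin n₁ ⊕ Fin n₂ → ℝ :=
  Lmat F₁ θ O *ᵥ xobs

/-- The imputed returns `x̂ = Πᵀ [F̃_mis ŝ; x_obs]`. -/
def xhat (F₁ : Matrix (Fin n) (Fin n₁) ℝ) (θ : Params n n₁ n₂) (O : Finset (Fin n))
    (xobs : {i // i ∈ O} → ℝ) : Fin n → ℝ :=
  merge O (Fmis F₁ θ O *ᵥ shat F₁ θ O xobs) xobs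

/-- `C_xx = ∑_τ w_τ E[X_τ X_τᵀ | X_{τ,obs} = x_{τ,obs}; θ]`. -/
def aggXX (F₁ : Matrix (Fin n) (Fin n₁) ℝ) (w : Fin T → ℝ) (O : Fin T → Finset (Fin n))
    (x : (τ : Fin T) → {i // i ∈ O τ} → ℝ) (θ : Params n n₁ n₂) : Matrix (Fin n) (Fin n) ℝ :=
  ∑ τ, w τ • condXX F₁ θ (O τ) (x τ)

/-- `W_xs = ∑_τ w_τ E[X_τ S_τᵀ | X_{τ,obs} = x_{τ,obs}; θ]`. -/
def aggXS (F₁ : Matrix (Fin n) (Fin n₁) ℝ) (w : Fin T → ℝ) (O : Fin T → Finset (Fin n))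
    (x : (τ : Fin T) → {i // i ∈ O τ} → ℝ) (θ : Params n n₁ n₂) :
    Matrix (Fin n) (Fin n₁ ⊕ Fin n₂) ℝ :=
  ∑ τ, w τ • condXS F₁ θ (O τ) (x τ)

/-- `C_ss = ∑_τ w_τ E[S_τ S_τᵀ | X_{τ,obs} = x_{τ,obs}; θ]`. -/
def aggSS (F₁ : Matrix (Fin n) (Fin n₁) ℝ) (w : Fin T → ℝ) (O : Fin T → Finset (Fin n))
    (x : (τ : Fin T) → {i // i ∈ O τ} → ℝ) (θ : Params n n₁ n₂) :
    Matrix (Fin n₁ ⊕ Fin n₂) (Fin n₁ ⊕ Fin n₂) ℝ :=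
  ∑ τ, w τ • condSS F₁ θ (O τ) (x τ)

/-- `Σ̃ = C + F₁ C_{ss,11} F₁ᵀ - 2 C_{xs,1} F₁ᵀ`. -/
def sigmaTilde (F₁ : Matrix (Fin n) (Fin n₁) ℝ) (C : Matrix (Fin n) (Fin n) ℝ)
    (Cxs : Matrix (Fin n) (Fin n₁ ⊕ Fin n₂) ℝ)
    (Css : Matrix (Fin n₁ ⊕ Fin n₂) (Fin n₁ ⊕ Fin n₂) ℝ) : Matrix (Fin n) (Fin n) ℝ :=
  C + F₁ * Css.toBlocks₁₁ * F₁ᵀ - (2 : ℝ) • (Cxs.toCols₁ * F₁ᵀ)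

/-- `C̃_xs = C_{xs,2} - F₁ C_{ss,12}`. -/
def cTilde (F₁ : Matrix (Fin n) (Fin n₁) ℝ)
    (Cxs : Matrix (Fin n) (Fin n₁ ⊕ Fin n₂) ℝ)
    (Css : Matrix (Fin n₁ ⊕ Fin n₂) (Fin n₁ ⊕ Fin n₂) ℝ) : Matrix (Fin n) (Fin n₂) ℝ :=
  Cxs.toCols₂ - F₁ * Css.toBlocks₁₂

/-- The closed-form M-step as a function of the second moments `C`, `C_xs`, `C_ss`. -/
def mStep (F₁ : Matrix (Fin n) (Fin n₁) ℝ) (C : Matrix (Fin n) (Fin n) ℝ)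
    (Cxs : Matrix (Fin n) (Fin n₁ ⊕ Fin n₂) ℝ)
    (Css : Matrix (Fin n₁ ⊕ Fin n₂) (Fin n₁ ⊕ Fin n₂) ℝ) : Params n n₁ n₂ where
  F₂ := cTilde F₁ Cxs Css * Css.toBlocks₂₂⁻¹
  Ω := Css.toBlocks₁₁
  D := Matrix.diagonal (Matrix.diag
    (sigmaTilde F₁ C Cxs Css - cTilde F₁ Cxs Css * Css.toBlocks₂₂⁻¹ * (cTilde F₁ Cxs Css)ᵀ))

/-- The objective minimized over `θ` in the M-step that starts from `θk`:
`∑_τ w_τ E[-2 log p_θ(X_τ, S_τ) | X_{τ,obs} = x_{τ,obs}; θk]`. -/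
def emObjective (F₁ : Matrix (Fin n) (Fin n₁) ℝ) (w : Fin T → ℝ) (O : Fin T → Finset (Fin n))
    (x : (τ : Fin T) → {i // i ∈ O τ} → ℝ) (θk θ : Params n n₁ n₂) : ℝ :=
  ∑ τ, w τ * ∫ z, -2 * Real.log (jointDensity F₁ θ (merge (O τ) z.1 (x τ)) z.2)
    ∂(condLaw F₁ θk (O τ) (x τ))

end

end FactorEM

open FactorEM

/-!
For positive definite `V` the Gaussian law has its usual density
(`gaussianLaw_eq_withDensity`), and since the shear `(s, e) ↦ (F s + e, s)` preserves Lebesgue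
measure, `p_θ` is the density of `(X, S)` (`map_shear_gaussianLaw_prod`).

**E-step.** The matrix `D` is diagonal, so the exponent of `p_θ(x, s)` splits into a part with the
missing and a part with the observed coordinates; completing the square in `s` in the latter
(`complete_square`) shows that, for each fixed `x_obs`,
`p_θ(x, s) = K · N(x_mis; F̃_mis s, D_mis) · N(s; ŝ, G)` with a constant `K > 0`
(`exists_jointDensity_merge_eq`). Hence `K` is the marginal density of `x_obs`, and the conditional
law is that of `(F̃_mis S + E, S)` with independent `S ∼ N(ŝ, G)` and `E ∼ N(0, D_mis)`
(`condLaw_eq_map`). All conditional moments follow from those of `S` and `E` (`moments_shear`), and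
Fubini's theorem identifies this family with the regular conditional distribution
(`withDensity_prod_eq_compProd`).

**M-step.** As `-2 log p_θ` is a quadratic polynomial in `(x, s)`, the objective depends only on the
aggregated second moments (`emObjective_eq_mObjective`). Completing the square in the rows of `F₂`
(`diag_residual_eq`) writes it as a sum of `d*_i / D_ii + log D_ii`, of nonnegative terms that vanish
exactly at the closed-form `F₂`, and of `tr (Ω⁻¹ C_ss,11) + log det Ω`. The last term is uniquely
minimized at `Ω = C_ss,11`, because `log det A ≤ tr A - n` with equality only at `A = 1`
(`log_det_add_card_le`); each `d / t + log t` has the minimizer `t = d` if `d > 0` and none otherwise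
(`isMinOn_mObjective_iff`).

The number `d*_i` is the smallest aggregated second moment of `X_i - F₁ S₁ - f S₂` over `f`. It is
positive unless at all times of positive weight this residual vanishes almost surely. For a missing
asset the noise prevents this; for an observed one `S` is nondegenerate and `X_i` is constant, so it
happens only if the loadings and the return are zero (`mStep_feasible_iff`).
-/

namespace FactorEM

/-! ### The density and the moments of a Gaussian law -/

/-- A product of measures on `ℝ` with integrable densities has the product density. -/
theorem pi_withDensity_ofReal {ι : Type*} [Fintype ι] (φ : ι → ℝ → ℝ) (hφ : ∀ i, Integrable (φ i))
    (hφ0 : ∀ i t, 0 ≤ φ i t) :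
    Measure.pi (fun i => (volume : Measure ℝ).withDensity fun t => ENNReal.ofReal (φ i t))
      = (volume : Measure (ι → ℝ)).withDensity fun x => ENNReal.ofReal (∏ i, φ i (x i)) := by
  have hfin : ∀ i, IsFiniteMeasure
      ((volume : Measure ℝ).withDensity fun t => ENNReal.ofReal (φ i t)) := fun i =>
    isFiniteMeasure_withDensity_ofReal (hφ i).2
  refine Measure.pi_eq fun s hs => ?_
  have hps : MeasurableSet (Set.univ.pi s) := MeasurableSet.univ_pi hs
  have hind : ∀ i, Integrable ((s i).indicator (φ i)) := fun i => (hφ i).indicator (hs i)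
  have key : (Set.univ.pi s).indicator (fun x : ι → ℝ => ∏ i, φ i (x i))
      = fun x => ∏ i, (s i).indicator (φ i) (x i) := by
    funext x
    by_cases hx : x ∈ Set.univ.pi s
    · rw [Set.indicator_of_mem hx]
      exact Finset.prod_congr rfl fun i _ => (Set.indicator_of_mem (hx i trivial) _).symm
    · rw [Set.indicator_of_notMem hx]
      obtain ⟨i, hi⟩ : ∃ i, x i ∉ s i := by simpa using hx
      exact (Finset.prod_eq_zero (Finset.mem_univ i) (Set.indicator_of_notMem hi _)).symm
  have hprod : Integrable (fun x : ι → ℝ => ∏ i, (s i).indicator (φ i) (x i)) :=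
    Integrable.fintype_prod hind
  have hnn : ∀ i t, 0 ≤ (s i).indicator (φ i) t := fun i t =>
    Set.indicator_nonneg (fun t _ => hφ0 i t) t
  have hstep : ∀ i, (volume : Measure ℝ).withDensity (fun t => ENNReal.ofReal (φ i t)) (s i)
      = ENNReal.ofReal (∫ t, (s i).indicator (φ i) t) := by
    intro i
    rw [withDensity_apply _ (hs i), ofReal_integral_eq_lintegral_ofReal (hind i)
      (ae_of_all _ (hnn i)), ← lintegral_indicator (hs i)]
    refine lintegral_congr fun t => ?_
    by_cases ht : t ∈ s i <;> simp [ht]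
  rw [withDensity_apply _ hps, Finset.prod_congr rfl fun i _ => hstep i,
    ← ENNReal.ofReal_prod_of_nonneg fun i _ => integral_nonneg (hnn i),
    ← integral_fintype_prod_volume_eq_prod (fun i => (s i).indicator (φ i)),
    ofReal_integral_eq_lintegral_ofReal hprod
      (ae_of_all _ fun x => Finset.prod_nonneg fun i _ => hnn i _), ← lintegral_indicator hps]
  refine lintegral_congr fun x => ?_
  rw [← congrFun key x]
  by_cases ht : x ∈ Set.univ.pi s
  · rw [Set.indicator_of_mem ht, Set.indicator_of_mem ht]
  · rw [Set.indicator_of_notMem ht, Set.indicator_of_notMem ht, ENNReal.ofReal_zero]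

theorem map_withDensity_comp {α β : Type*} [MeasurableSpace α] [MeasurableSpace β] (μ : Measure α)
    {T : α → β} (hT : Measurable T) {g : β → ENNReal} (hg : Measurable g) :
    (μ.withDensity (g ∘ T)).map T = (μ.map T).withDensity g := by
  ext s hs
  rw [Measure.map_apply hT hs, withDensity_apply _ (hT hs), withDensity_apply _ hs,
    setLIntegral_map hs hg hT]
  rfl

theorem continuous_gaussianDensity {ι : Type} [Fintype ι] [DecidableEq ι]
    (μ : ι → ℝ) (V : Matrix ι ι ℝ) : Continuous (gaussianDensity μ V) := by
  unfold gaussianDensity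
  simp only [dotProduct, mulVec]
  fun_prop

/-- The standard Gaussian law on `ι → ℝ` has density `(2π)^{-|ι|/2} exp(-|x|²/2)`. -/
theorem pi_gaussianReal_eq_withDensity (ι : Type) [Fintype ι] [DecidableEq ι] :
    Measure.pi (fun _ : ι => gaussianReal 0 1)
      = volume.withDensity fun x => ENNReal.ofReal (gaussianDensity 0 (1 : Matrix ι ι ℝ) x) := by
  have h := pi_withDensity_ofReal (fun _ : ι => gaussianPDFReal 0 1)
    (fun _ => integrable_gaussianPDFReal 0 1) (fun _ => gaussianPDFReal_nonneg 0 1)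
  have h1 : gaussianReal 0 1
      = (volume : Measure ℝ).withDensity fun t => ENNReal.ofReal (gaussianPDFReal 0 1 t) :=
    gaussianReal_of_var_ne_zero 0 one_ne_zero
  rw [h1, h]
  congr 1
  funext x
  congr 1
  simp only [gaussianPDFReal, gaussianDensity, Finset.prod_mul_distrib, ← Real.exp_sum,
    Finset.prod_const, Finset.card_univ, sub_zero, det_one, inv_one, one_mulVec, mul_one,
    NNReal.coe_one, dotProduct]
  congr 1
  · rw [inv_pow, Real.sqrt_eq_rpow, Real.sqrt_eq_rpow, ← Real.rpow_natCast, ← Real.rpow_mul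
      (by positivity), ← Real.rpow_natCast, ← Real.rpow_mul (by positivity), mul_comm (1 / 2 : ℝ)]
  · rw [Finset.mul_sum]
    congr 1
    exact Finset.sum_congr rfl fun i _ => by ring

open scoped MatrixOrder in
theorem sqrt_posDef_spec {ι : Type*} [Fintype ι] [DecidableEq ι] {V : Matrix ι ι ℝ}
    (hV : V.PosDef) : (CFC.sqrt V)ᵀ = CFC.sqrt V ∧ CFC.sqrt V * CFC.sqrt V = V ∧
      (CFC.sqrt V).det ≠ 0 := by
  have hRR : CFC.sqrt V * CFC.sqrt V = V := CFC.sqrt_mul_sqrt_self V hV.posSemidef.nonneg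
  refine ⟨?_, hRR, fun h0 => ?_⟩
  · have h := (CFC.sqrt_nonneg V).isSelfAdjoint.star_eq
    rwa [star_eq_conjTranspose, conjTranspose_eq_transpose_of_trivial] at h
  · have := hV.det_pos
    rw [← hRR, det_mul, h0, mul_zero] at this
    exact lt_irrefl _ this

open scoped MatrixOrder in
theorem gaussianLaw_eq_map {ι : Type} [Fintype ι] [DecidableEq ι] (μ : ι → ℝ)
    (V : Matrix ι ι ℝ) : gaussianLaw μ V
      = (Measure.pi fun _ : ι => gaussianReal 0 1).map fun y => μ + CFC.sqrt V *ᵥ y := by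
  rw [gaussianLaw, multivariateGaussian, ← map_pi_eq_stdGaussian,
    Measure.map_map (by fun_prop) (by fun_prop), Measure.map_map (by fun_prop) (by fun_prop)]
  rfl

open scoped MatrixOrder in
theorem gaussianLaw_eq_withDensity {ι : Type} [Fintype ι] [DecidableEq ι] (μ : ι → ℝ)
    {V : Matrix ι ι ℝ} (hV : V.PosDef) :
    gaussianLaw μ V = volume.withDensity fun x => ENNReal.ofReal (gaussianDensity μ V x) := by
  have hlaw := gaussianLaw_eq_map μ V
  obtain ⟨hRt, hRR, hdet⟩ := sqrt_posDef_spec hV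
  generalize CFC.sqrt V = R at hlaw hRt hRR hdet
  have hT : Measurable fun y : ι → ℝ => μ + R *ᵥ y := by fun_prop
  have hvol : (volume : Measure (ι → ℝ)).map (fun y => μ + R *ᵥ y)
      = ENNReal.ofReal |R.det⁻¹| • volume := by
    have : (fun y : ι → ℝ => μ + R *ᵥ y) = (fun y => μ + y) ∘ toLin' R := rfl
    rw [this, ← Measure.map_map (by fun_prop) (by fun_prop),
      Real.map_matrix_volume_pi_eq_smul_volume_pi hdet, Measure.map_smul, map_add_left_eq_self]
  have hquad : ∀ y : ι → ℝ, (R *ᵥ y) ⬝ᵥ (V⁻¹ *ᵥ (R *ᵥ y)) = y ⬝ᵥ y := by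
    intro y
    have h1 : R * V⁻¹ * R = 1 := by
      rw [← hRR, Matrix.mul_inv_rev, ← mul_assoc, mul_nonsing_inv _ (isUnit_iff_ne_zero.2 hdet), one_mul,
        nonsing_inv_mul _ (isUnit_iff_ne_zero.2 hdet)]
    have h2 : R *ᵥ y = y ᵥ* R := by rw [← vecMul_transpose, hRt]
    conv_lhs => lhs; rw [h2]
    rw [← dotProduct_mulVec, mulVec_mulVec, mulVec_mulVec, h1, one_mulVec]
  have hcomp : (fun y : ι → ℝ => ENNReal.ofReal (gaussianDensity 0 (1 : Matrix ι ι ℝ) y))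
      = (fun x => ENNReal.ofReal |R.det| * ENNReal.ofReal (gaussianDensity μ V x))
        ∘ fun y => μ + R *ᵥ y := by
    funext y
    have hsq : Real.sqrt ((2 * Real.pi) ^ Fintype.card ι * V.det)
        = |R.det| * Real.sqrt ((2 * Real.pi) ^ Fintype.card ι) := by
      rw [← hRR, det_mul, Real.sqrt_mul (by positivity), Real.sqrt_mul_self_eq_abs, mul_comm]
    simp only [Function.comp, gaussianDensity, add_sub_cancel_left, hquad, hsq]
    rw [← ENNReal.ofReal_mul (abs_nonneg _)]
    congr 1
    have : |R.det| ≠ 0 := abs_ne_zero.2 hdet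
    simp only [sub_zero, det_one, inv_one, one_mulVec, mul_one]
    field_simp
  rw [hlaw, pi_gaussianReal_eq_withDensity, hcomp, map_withDensity_comp _ hT, hvol]
  · have hm : Measurable fun x => ENNReal.ofReal (gaussianDensity μ V x) :=
      (continuous_gaussianDensity μ V).measurable.ennreal_ofReal
    have : (fun x => ENNReal.ofReal |R.det| * ENNReal.ofReal (gaussianDensity μ V x))
      = ENNReal.ofReal |R.det| • fun x => ENNReal.ofReal (gaussianDensity μ V x) := rfl
    rw [this, withDensity_smul _ hm, withDensity_smul_measure, smul_smul,
      ← ENNReal.ofReal_mul (abs_nonneg _), ← abs_mul, mul_inv_cancel₀ hdet]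
    simp
  · exact ((continuous_gaussianDensity μ V).measurable.ennreal_ofReal).const_mul _

theorem gaussianDensity_pos {ι : Type} [Fintype ι] [DecidableEq ι] (μ : ι → ℝ)
    {V : Matrix ι ι ℝ} (hV : V.PosDef) (x : ι → ℝ) : 0 < gaussianDensity μ V x := by
  have := hV.det_pos
  unfold gaussianDensity
  positivity

theorem memLp_eval_gaussianLaw {ι : Type} [Fintype ι] [DecidableEq ι] (μ : ι → ℝ)
    (V : Matrix ι ι ℝ) (a : ι) : MemLp (fun s => s a) 2 (gaussianLaw μ V) := by
  unfold gaussianLaw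
  rw [memLp_map_measure_iff (Continuous.aestronglyMeasurable (by fun_prop)) (by fun_prop)]
  have h : MemLp id 2 (multivariateGaussian (WithLp.toLp 2 μ) V) := IsGaussian.memLp_two_id
  exact (EuclideanSpace.proj (𝕜 := ℝ) a).comp_memLp' h

theorem integral_eval_gaussianLaw {ι : Type} [Fintype ι] [DecidableEq ι] (μ : ι → ℝ)
    (V : Matrix ι ι ℝ) (a : ι) : ∫ s, s a ∂(gaussianLaw μ V) = μ a := by
  unfold gaussianLaw
  rw [integral_map (by fun_prop) (Continuous.aestronglyMeasurable (by fun_prop))]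
  have h := (EuclideanSpace.proj (𝕜 := ℝ) a).integral_comp_comm
    (IsGaussian.integrable_id (μ := multivariateGaussian (WithLp.toLp 2 μ) V))
  simpa using h

theorem integral_mul_gaussianLaw {ι : Type} [Fintype ι] [DecidableEq ι] (μ : ι → ℝ)
    {V : Matrix ι ι ℝ} (hV : V.PosSemidef) (a b : ι) :
    ∫ s, s a * s b ∂(gaussianLaw μ V) = V a b + μ a * μ b := by
  have h := covariance_eval_multivariateGaussian (μ := WithLp.toLp 2 μ) hV a b
  have hm : ∀ a, MemLp (fun x : EuclideanSpace ℝ ι => x a) 2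
      (multivariateGaussian (WithLp.toLp 2 μ) V) := fun a =>
    (EuclideanSpace.proj (𝕜 := ℝ) a).comp_memLp' IsGaussian.memLp_two_id
  have hi : ∀ a, ∫ x : EuclideanSpace ℝ ι, x a ∂(multivariateGaussian (WithLp.toLp 2 μ) V)
      = μ a := by
    intro a
    have := integral_eval_gaussianLaw μ V a
    rwa [gaussianLaw, integral_map (by fun_prop)
      (Continuous.aestronglyMeasurable (by fun_prop))] at this
  rw [covariance_eq_sub (hm a) (hm b), hi, hi] at h
  rw [gaussianLaw, integral_map (by fun_prop)
    (Continuous.aestronglyMeasurable (by fun_prop)), ← h]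
  simp

/-! ### Linear Gaussian regression -/

/-- If `S ∼ N(a, U)` and `E ∼ N(0, V)` are independent, then `(F S + E, S)` has density
`N(x; F s, V) N(s; a, U)`: the shear `(s, e) ↦ (F s + e, s)` preserves Lebesgue measure. -/
theorem map_shear_gaussianLaw_prod {κ ι : Type} [Fintype κ] [DecidableEq κ] [Fintype ι]
    [DecidableEq ι] (F : Matrix κ ι ℝ) (a : ι → ℝ) {U : Matrix ι ι ℝ} {V : Matrix κ κ ℝ}
    (hU : U.PosDef) (hV : V.PosDef) :
    ((gaussianLaw a U).prod (gaussianLaw 0 V)).map (fun z => (F *ᵥ z.1 + z.2, z.1))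
      = volume.withDensity fun z : (κ → ℝ) × (ι → ℝ) =>
          ENNReal.ofReal (gaussianDensity (F *ᵥ z.2) V z.1 * gaussianDensity a U z.2) := by
  have hmU := (continuous_gaussianDensity a U).measurable
  have hmV := (continuous_gaussianDensity 0 V).measurable
  have hshear : ∀ (s : ι → ℝ) (e : κ → ℝ),
      gaussianDensity (F *ᵥ s) V e = gaussianDensity 0 V (e - F *ᵥ s) := by
    intro s e
    simp [gaussianDensity]
  have hvol : MeasurePreserving
      (fun z : (ι → ℝ) × (κ → ℝ) => (F *ᵥ z.1 + z.2, z.1)) volume volume := by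
    have h1 : MeasurePreserving (fun z : (ι → ℝ) × (κ → ℝ) => (id z.1, F *ᵥ z.1 + z.2))
        ((volume : Measure (ι → ℝ)).prod (volume : Measure (κ → ℝ)))
        ((volume : Measure (ι → ℝ)).prod (volume : Measure (κ → ℝ))) :=
      (MeasurePreserving.id _).skew_product (g := fun s e => F *ᵥ s + e)
        (by unfold Function.uncurry; fun_prop) (ae_of_all _ fun s => map_add_left_eq_self _ _)
    exact (Measure.measurePreserving_swap).comp h1
  rw [gaussianLaw_eq_withDensity a hU, gaussianLaw_eq_withDensity 0 hV,
    prod_withDensity hmU.ennreal_ofReal hmV.ennreal_ofReal, ← Measure.volume_eq_prod,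
    ← hvol.map_eq, ← map_withDensity_comp _ hvol.measurable]
  · congr 2
    funext z
    simp only [Function.comp, hshear, add_sub_cancel_left]
    rw [mul_comm, ENNReal.ofReal_mul (gaussianDensity_pos 0 hV _).le]
  · simp only [hshear]
    exact ((hmV.comp (by fun_prop)).mul (hmU.comp measurable_snd)).ennreal_ofReal

theorem dotProduct_mulVec_comm_of_symm {ι : Type*} [Fintype ι] {M : Matrix ι ι ℝ} (hM : Mᵀ = M)
    (u v : ι → ℝ) : u ⬝ᵥ (M *ᵥ v) = v ⬝ᵥ (M *ᵥ u) := by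
  rw [dotProduct_mulVec, ← mulVec_transpose, hM, dotProduct_comm]

/-- The quadratic forms of a Gaussian linear regression combine into that of the posterior, with
precision `Aᵀ W A + P`. -/
theorem complete_square {κ ι : Type*} [Fintype κ] [Fintype ι] {A : Matrix κ ι ℝ}
    {W : Matrix κ κ ℝ} {P H : Matrix ι ι ℝ} (hW : Wᵀ = W) (hP : Pᵀ = P) (hH : H = Aᵀ * W * A + P)
    {x : κ → ℝ} {m : ι → ℝ} (hm : H *ᵥ m = (Aᵀ * W) *ᵥ x) (s : ι → ℝ) :
    (x - A *ᵥ s) ⬝ᵥ (W *ᵥ (x - A *ᵥ s)) + s ⬝ᵥ (P *ᵥ s)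
      = (s - m) ⬝ᵥ (H *ᵥ (s - m)) + (x ⬝ᵥ (W *ᵥ x) - m ⬝ᵥ (H *ᵥ m)) := by
  have hHt : Hᵀ = H := by
    rw [hH, transpose_add, transpose_mul, transpose_mul, hW, hP, transpose_transpose, Matrix.mul_assoc]
  have h1 : ∀ (u : ι → ℝ) (v : κ → ℝ), u ⬝ᵥ ((Aᵀ * W) *ᵥ v) = (A *ᵥ u) ⬝ᵥ (W *ᵥ v) := by
    intro u v
    rw [← mulVec_mulVec, dotProduct_mulVec, vecMul_transpose]
  have h2 : s ⬝ᵥ (H *ᵥ s) = (A *ᵥ s) ⬝ᵥ (W *ᵥ (A *ᵥ s)) + s ⬝ᵥ (P *ᵥ s) := by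
    rw [hH, add_mulVec, dotProduct_add, ← mulVec_mulVec, h1]
  have h3 : s ⬝ᵥ (H *ᵥ m) = (A *ᵥ s) ⬝ᵥ (W *ᵥ x) := by rw [hm, h1]
  simp only [mulVec_sub, dotProduct_sub, sub_dotProduct]
  rw [dotProduct_mulVec_comm_of_symm hHt m s, dotProduct_mulVec_comm_of_symm hW x (A *ᵥ s), h2, h3]
  ring

/-! ### The joint density and its factorization given the observed coordinates -/

variable {n n₁ n₂ T : ℕ}

theorem Params.Feasible.posDef_D {θ : Params n n₁ n₂} (h : θ.Feasible) : θ.D.PosDef := by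
  rw [← h.2.1.diagonal_diag]
  exact PosDef.diagonal h.2.2

theorem Params.Feasible.posDef_Otilde {θ : Params n n₁ n₂} (h : θ.Feasible) :
    θ.Otilde.PosDef := by
  have hu := h.1.isUnit.invertible
  have hd : ∀ v : Fin n₁ ⊕ Fin n₂ → ℝ, v ⬝ᵥ (θ.Otilde *ᵥ v)
      = (v ∘ Sum.inl) ⬝ᵥ (θ.Ω *ᵥ (v ∘ Sum.inl)) + (v ∘ Sum.inr) ⬝ᵥ (v ∘ Sum.inr) := by
    intro v
    have hv : v = Sum.elim (v ∘ Sum.inl) (v ∘ Sum.inr) := (Sum.elim_comp_inl_inr v).symm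
    rw [Params.Otilde]
    conv_lhs => rw [hv, fromBlocks_mulVec, sumElim_dotProduct_sumElim]
    simp
  refine PosDef.of_dotProduct_mulVec_pos ?_ fun {v} hv => ?_
  · have h1 : θ.Ωᴴ = θ.Ω := h.1.isHermitian
    rw [Matrix.IsHermitian, Params.Otilde, fromBlocks_conjTranspose, h1]
    simp
  · rw [star_trivial, hd]
    by_cases h1 : v ∘ Sum.inl = 0
    · have h2 : v ∘ Sum.inr ≠ 0 := by
        intro h2
        exact hv (funext fun i => i.casesOn (fun i => congrFun h1 i) fun i => congrFun h2 i)
      rw [h1]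
      have := dotProduct_self_star_pos_iff.2 h2
      simpa using this
    · have h3 := h.1.dotProduct_mulVec_pos h1
      have h4 : 0 ≤ (v ∘ Sum.inr) ⬝ᵥ (v ∘ Sum.inr) := dotProduct_self_star_nonneg _
      rw [star_trivial] at h3
      linarith

theorem Params.Feasible.posDef_Dobs {θ : Params n n₁ n₂} (h : θ.Feasible) (O : Finset (Fin n)) :
    (Dobs θ O).PosDef :=
  h.posDef_D.submatrix Subtype.val_injective

theorem Params.Feasible.posDef_Dmis {θ : Params n n₁ n₂} (h : θ.Feasible) (O : Finset (Fin n)) :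
    (Dmis θ O).PosDef :=
  h.posDef_D.submatrix Subtype.val_injective

theorem Params.Feasible.posDef_precision {θ : Params n n₁ n₂} (h : θ.Feasible)
    (F₁ : Matrix (Fin n) (Fin n₁) ℝ) (O : Finset (Fin n)) :
    ((Fobs F₁ θ O)ᵀ * (Dobs θ O)⁻¹ * Fobs F₁ θ O + θ.Otilde⁻¹).PosDef :=
  PosDef.posSemidef_add
    ((h.posDef_Dobs O).inv.posSemidef.conjTranspose_mul_mul_same (Fobs F₁ θ O))
    h.posDef_Otilde.inv

theorem Params.Feasible.posDef_Gmat {θ : Params n n₁ n₂} (h : θ.Feasible)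
    (F₁ : Matrix (Fin n) (Fin n₁) ℝ) (O : Finset (Fin n)) : (Gmat F₁ θ O).PosDef :=
  (h.posDef_precision F₁ O).inv

/-- The joint law of `(X, S)` has density `p_θ`. -/
theorem modelLaw_eq_withDensity (F₁ : Matrix (Fin n) (Fin n₁) ℝ) {θ : Params n n₁ n₂}
    (h : θ.Feasible) : modelLaw F₁ θ =
      volume.withDensity fun z => ENNReal.ofReal (jointDensity F₁ θ z.1 z.2) :=
  map_shear_gaussianLaw_prod _ _ h.posDef_Otilde h.posDef_D

theorem inv_of_isDiag {ι : Type*} [Fintype ι] [DecidableEq ι] {D : Matrix ι ι ℝ}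
    (hD : D.IsDiag) (h : ∀ i, 0 < D i i) : D⁻¹ = diagonal fun i => (D i i)⁻¹ := by
  refine inv_eq_right_inv ?_
  conv_lhs => lhs; rw [← hD.diagonal_diag]
  rw [diagonal_mul_diagonal, ← diagonal_one]
  congr 1
  funext i
  exact mul_inv_cancel₀ (h i).ne'

theorem dotProduct_inv_mulVec_of_isDiag {ι : Type*} [Fintype ι] [DecidableEq ι]
    {D : Matrix ι ι ℝ} (hD : D.IsDiag) (h : ∀ i, 0 < D i i) (v : ι → ℝ) :
    v ⬝ᵥ (D⁻¹ *ᵥ v) = ∑ i, v i ^ 2 / D i i := by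
  simp only [inv_of_isDiag hD h, dotProduct, mulVec_diagonal]
  exact Finset.sum_congr rfl fun i _ => by rw [div_eq_mul_inv]; ring

/-- Given `x_obs`, the joint density is proportional to the density of
`S ∼ N(ŝ, G)`, `X_mis ∣ S ∼ N(F̃_mis S, D_mis)`. -/
theorem exists_jointDensity_merge_eq (F₁ : Matrix (Fin n) (Fin n₁) ℝ) {θ : Params n n₁ n₂}
    (h : θ.Feasible) (O : Finset (Fin n)) (xobs : {i // i ∈ O} → ℝ) :
    ∃ K : ℝ, 0 < K ∧ ∀ (xmis : {i // i ∉ O} → ℝ) (s : Fin n₁ ⊕ Fin n₂ → ℝ),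
      jointDensity F₁ θ (merge O xmis xobs) s
        = K * (gaussianDensity (Fmis F₁ θ O *ᵥ s) (Dmis θ O) xmis
            * gaussianDensity (shat F₁ θ O xobs) (Gmat F₁ θ O) s) := by
  set H := (Fobs F₁ θ O)ᵀ * (Dobs θ O)⁻¹ * Fobs F₁ θ O + θ.Otilde⁻¹ with hH
  have hHp : H.PosDef := h.posDef_precision F₁ O
  have hHu : IsUnit H.det := (isUnit_iff_isUnit_det _).1 hHp.isUnit
  have hG : (Gmat F₁ θ O)⁻¹ = H := nonsing_inv_nonsing_inv H hHu
  have hm : H *ᵥ shat F₁ θ O xobs = ((Fobs F₁ θ O)ᵀ * (Dobs θ O)⁻¹) *ᵥ xobs := by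
    rw [shat, Lmat, mulVec_mulVec, Gmat, ← hH, Matrix.mul_assoc H⁻¹, ← Matrix.mul_assoc H,
      mul_nonsing_inv _ hHu, Matrix.one_mul]
  have hsym : ∀ {ι : Type} [Fintype ι] [DecidableEq ι] {M : Matrix ι ι ℝ}, M.PosDef →
      (M⁻¹)ᵀ = M⁻¹ := by
    intro ι _ _ M hM
    have := hM.inv.isHermitian
    rwa [Matrix.IsHermitian, conjTranspose_eq_transpose_of_trivial] at this
  have hsq := complete_square (hsym (h.posDef_Dobs O)) (hsym h.posDef_Otilde) hH hm
  have hsplit : ∀ (xmis : {i // i ∉ O} → ℝ) (s : Fin n₁ ⊕ Fin n₂ → ℝ),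
      (merge O xmis xobs - θ.Ftilde F₁ *ᵥ s) ⬝ᵥ
          (θ.D⁻¹ *ᵥ (merge O xmis xobs - θ.Ftilde F₁ *ᵥ s))
        = (xobs - Fobs F₁ θ O *ᵥ s) ⬝ᵥ ((Dobs θ O)⁻¹ *ᵥ (xobs - Fobs F₁ θ O *ᵥ s))
          + (xmis - Fmis F₁ θ O *ᵥ s) ⬝ᵥ ((Dmis θ O)⁻¹ *ᵥ (xmis - Fmis F₁ θ O *ᵥ s)) := by
    intro xmis s
    rw [dotProduct_inv_mulVec_of_isDiag h.2.1 h.2.2,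
      dotProduct_inv_mulVec_of_isDiag (D := Dobs θ O) (h.2.1.submatrix Subtype.val_injective)
        fun i => h.2.2 i,
      dotProduct_inv_mulVec_of_isDiag (D := Dmis θ O) (h.2.1.submatrix Subtype.val_injective)
        fun i => h.2.2 i, ← Fintype.sum_subtype_add_sum_subtype (fun i => i ∈ O)]
    congr 1
    · refine Finset.sum_congr (by ext; simp) fun i _ => ?_
      simp only [Pi.sub_apply, merge_apply, i.2, dif_pos]
      rfl
    · refine Finset.sum_congr (by ext; simp) fun i _ => ?_
      simp only [Pi.sub_apply, merge_apply, i.2, dif_neg, not_false_eq_true]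
      rfl
  have hD := h.posDef_D.det_pos
  have hΩ := h.posDef_Otilde.det_pos
  have hM := (h.posDef_Dmis O).det_pos
  have hGd := (h.posDef_Gmat F₁ O).det_pos
  refine ⟨(Real.sqrt ((2 * Real.pi) ^ Fintype.card (Fin n) * θ.D.det))⁻¹
    * (Real.sqrt ((2 * Real.pi) ^ Fintype.card (Fin n₁ ⊕ Fin n₂) * θ.Otilde.det))⁻¹
    * Real.sqrt ((2 * Real.pi) ^ Fintype.card {i // i ∉ O} * (Dmis θ O).det)
    * Real.sqrt ((2 * Real.pi) ^ Fintype.card (Fin n₁ ⊕ Fin n₂) * (Gmat F₁ θ O).det)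
    * Real.exp (-(1 / 2) * (xobs ⬝ᵥ ((Dobs θ O)⁻¹ *ᵥ xobs)
        - shat F₁ θ O xobs ⬝ᵥ (H *ᵥ shat F₁ θ O xobs))), by positivity, fun xmis s => ?_⟩
  have hs := hsq s
  unfold jointDensity gaussianDensity
  rw [hsplit, hG, sub_zero]
  generalize ha : (xobs - Fobs F₁ θ O *ᵥ s) ⬝ᵥ ((Dobs θ O)⁻¹ *ᵥ (xobs - Fobs F₁ θ O *ᵥ s)) = a
    at hs ⊢
  generalize hb : s ⬝ᵥ (θ.Otilde⁻¹ *ᵥ s) = b at hs ⊢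
  have hs' : a = (s - shat F₁ θ O xobs) ⬝ᵥ (H *ᵥ (s - shat F₁ θ O xobs))
    + (xobs ⬝ᵥ ((Dobs θ O)⁻¹ *ᵥ xobs) - shat F₁ θ O xobs ⬝ᵥ (H *ᵥ shat F₁ θ O xobs)) - b := by
    linarith
  rw [hs']
  generalize (s - shat F₁ θ O xobs) ⬝ᵥ (H *ᵥ (s - shat F₁ θ O xobs)) = c
  generalize (xobs ⬝ᵥ ((Dobs θ O)⁻¹ *ᵥ xobs) - shat F₁ θ O xobs ⬝ᵥ (H *ᵥ shat F₁ θ O xobs)) = d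
  generalize ((xmis - Fmis F₁ θ O *ᵥ s) ⬝ᵥ ((Dmis θ O)⁻¹ *ᵥ (xmis - Fmis F₁ θ O *ᵥ s))) = e
  have hexp : Real.exp (-(1 / 2) * (c + d - b + e)) * Real.exp (-(1 / 2) * b)
      = Real.exp (-(1 / 2) * d) * Real.exp (-(1 / 2) * e) * Real.exp (-(1 / 2) * c) := by
    rw [← Real.exp_add, ← Real.exp_add, ← Real.exp_add]
    congr 1
    ring
  have hM' : Real.sqrt ((2 * Real.pi) ^ Fintype.card {i // i ∉ O} * (Dmis θ O).det) ≠ 0 := by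
    positivity
  have hG' : Real.sqrt ((2 * Real.pi) ^ Fintype.card (Fin n₁ ⊕ Fin n₂) * (Gmat F₁ θ O).det) ≠ 0 := by
    positivity
  generalize Real.sqrt ((2 * Real.pi) ^ Fintype.card {i // i ∉ O} * (Dmis θ O).det) = p at hM' ⊢
  generalize Real.sqrt ((2 * Real.pi) ^ Fintype.card (Fin n₁ ⊕ Fin n₂) * (Gmat F₁ θ O).det) = q
    at hG' ⊢
  calc _ = _ * (Real.exp (-(1 / 2) * (c + d - b + e)) * Real.exp (-(1 / 2) * b)) :=
        mul_mul_mul_comm _ _ _ _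
    _ = _ := by
        rw [hexp]
        field_simp

/-- The conditional law of `(X_mis, S)` given `X_obs` is that of `(F̃_mis S + E, S)` with
independent `S ∼ N(ŝ, G)` and `E ∼ N(0, D_mis)`, and the marginal density of `X_obs` is positive. -/
theorem condLaw_eq_map (F₁ : Matrix (Fin n) (Fin n₁) ℝ) {θ : Params n n₁ n₂}
    (h : θ.Feasible) (O : Finset (Fin n)) (xobs : {i // i ∈ O} → ℝ) :
    0 < obsDensity F₁ θ O xobs ∧ condLaw F₁ θ O xobs =
      ((gaussianLaw (shat F₁ θ O xobs) (Gmat F₁ θ O)).prod (gaussianLaw 0 (Dmis θ O))).map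
        (fun z => (Fmis F₁ θ O *ᵥ z.1 + z.2, z.1)) := by
  obtain ⟨K, hK, hfac⟩ := exists_jointDensity_merge_eq F₁ h O xobs
  have hlaw := map_shear_gaussianLaw_prod (Fmis F₁ θ O) (shat F₁ θ O xobs)
    (h.posDef_Gmat F₁ O) (h.posDef_Dmis O)
  set f : Latent n₁ n₂ O → ℝ := fun z =>
    gaussianDensity (Fmis F₁ θ O *ᵥ z.2) (Dmis θ O) z.1
      * gaussianDensity (shat F₁ θ O xobs) (Gmat F₁ θ O) z.2 with hf
  have hf0 : ∀ z, 0 ≤ f z := fun z =>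
    (mul_pos (gaussianDensity_pos _ (h.posDef_Dmis O) _)
      (gaussianDensity_pos _ (h.posDef_Gmat F₁ O) _)).le
  have hint : ∫ z, f z = 1 := by
    have hprob : IsProbabilityMeasure (volume.withDensity fun z => ENNReal.ofReal (f z)) := by
      rw [← hlaw]
      exact Measure.isProbabilityMeasure_map (by fun_prop)
    have h1 : ∫⁻ z, ENNReal.ofReal (f z) = 1 := by
      have := hprob.measure_univ
      rwa [withDensity_apply _ MeasurableSet.univ, setLIntegral_univ] at this
    have hfm : Continuous f := by
      simp only [hf, gaussianDensity, dotProduct, mulVec]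
      fun_prop
    rw [integral_eq_lintegral_of_nonneg_ae (ae_of_all _ hf0)
      hfm.measurable.aestronglyMeasurable, h1, ENNReal.toReal_one]
  have hobs : obsDensity F₁ θ O xobs = K := by
    unfold obsDensity
    simp only [hfac]
    rw [integral_const_mul]
    change K * ∫ z, f z = K
    rw [hint, mul_one]
  refine ⟨hobs ▸ hK, ?_⟩
  rw [hlaw, condLaw, hobs]
  congr 1
  funext z
  rw [hfac, mul_div_cancel_left₀ _ hK.ne']

/-! ### The conditional law given the observed coordinates -/

/-- Disintegration of a measure with a density: if `g` is the (positive, finite) marginal density,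
the conditional measures have densities `f (a, ·) / g a`. -/
theorem withDensity_prod_eq_compProd {α β : Type*} [MeasurableSpace α] [MeasurableSpace β]
    (μ : Measure α) (ν : Measure β) [SFinite μ] [SFinite ν] {f : α × β → ENNReal}
    (hf : Measurable f) {g : α → ENNReal} (hg : ∀ a, g a = ∫⁻ b, f (a, b) ∂ν)
    (hg0 : ∀ a, g a ≠ 0) (hgt : ∀ a, g a ≠ ⊤) (κ : Kernel α β) [IsSFiniteKernel κ]
    (hκ : ∀ a, κ a = ν.withDensity fun b => f (a, b) / g a) :
    (μ.prod ν).withDensity f = (((μ.prod ν).withDensity f).map Prod.fst) ⊗ₘ κ := by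
  have hgm : Measurable g := by
    rw [funext hg]
    exact hf.lintegral_prod_right' (ν := ν)
  have hfst : ((μ.prod ν).withDensity f).map Prod.fst = μ.withDensity g := by
    ext s hs
    rw [Measure.map_apply measurable_fst hs, withDensity_apply _ (measurable_fst hs),
      withDensity_apply _ hs, ← lintegral_indicator (measurable_fst hs),
      lintegral_prod _ (hf.indicator (measurable_fst hs)).aemeasurable, ← lintegral_indicator hs]
    refine lintegral_congr fun a => ?_
    by_cases ha : a ∈ s
    · simp [ha, hg, Set.indicator]
    · simp [ha, Set.indicator]
  rw [hfst]
  ext s hs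
  rw [withDensity_apply _ hs, Measure.compProd_apply hs, ← lintegral_indicator hs,
    lintegral_prod _ (hf.indicator hs).aemeasurable,
    lintegral_withDensity_eq_lintegral_mul _ hgm (Kernel.measurable_kernel_prodMk_left hs)]
  refine lintegral_congr fun a => ?_
  have hsa : MeasurableSet (Prod.mk a ⁻¹' s) := measurable_prodMk_left hs
  have hqm : Measurable fun b => f (a, b) / g a :=
    (hf.comp measurable_prodMk_left).div_const _
  rw [Pi.mul_apply, hκ, withDensity_apply _ hsa, ← lintegral_indicator hsa,
    ← lintegral_const_mul _ (hqm.indicator hsa)]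
  refine lintegral_congr fun b => ?_
  by_cases hb : (a, b) ∈ s
  · have hb' : b ∈ Prod.mk a ⁻¹' s := hb
    rw [Set.indicator_of_mem hb, Set.indicator_of_mem hb', ENNReal.mul_div_cancel (hg0 a) (hgt a)]
  · have hb' : b ∉ Prod.mk a ⁻¹' s := hb
    rw [Set.indicator_of_notMem hb, Set.indicator_of_notMem hb', mul_zero]

theorem isProbabilityMeasure_condLaw (F₁ : Matrix (Fin n) (Fin n₁) ℝ) {θ : Params n n₁ n₂}
    (h : θ.Feasible) (O : Finset (Fin n)) (xobs : {i // i ∈ O} → ℝ) :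
    IsProbabilityMeasure (condLaw F₁ θ O xobs) := by
  rw [(condLaw_eq_map F₁ h O xobs).2]
  exact Measure.isProbabilityMeasure_map (by fun_prop)

theorem continuous_jointDensity_merge (F₁ : Matrix (Fin n) (Fin n₁) ℝ) (θ : Params n n₁ n₂)
    (O : Finset (Fin n)) : Continuous fun p : ({i // i ∈ O} → ℝ) × Latent n₁ n₂ O =>
      jointDensity F₁ θ (merge O p.2.1 p.1) p.2.2 := by
  have h : Continuous fun p : ({i // i ∈ O} → ℝ) × Latent n₁ n₂ O => merge O p.2.1 p.1 := by
    refine continuous_pi fun i => ?_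
    simp only [merge_apply]
    split_ifs <;> fun_prop
  simp only [jointDensity, gaussianDensity, dotProduct, mulVec]
  fun_prop

theorem jointDensity_pos (F₁ : Matrix (Fin n) (Fin n₁) ℝ) {θ : Params n n₁ n₂} (h : θ.Feasible)
    (x : Fin n → ℝ) (s : Fin n₁ ⊕ Fin n₂ → ℝ) : 0 < jointDensity F₁ θ x s :=
  mul_pos (gaussianDensity_pos _ h.posDef_D _) (gaussianDensity_pos _ h.posDef_Otilde _)

theorem lintegral_jointDensity_merge (F₁ : Matrix (Fin n) (Fin n₁) ℝ) {θ : Params n n₁ n₂}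
    (h : θ.Feasible) (O : Finset (Fin n)) (xobs : {i // i ∈ O} → ℝ) :
    ENNReal.ofReal (obsDensity F₁ θ O xobs)
      = ∫⁻ z : Latent n₁ n₂ O, ENNReal.ofReal (jointDensity F₁ θ (merge O z.1 xobs) z.2) := by
  have hpos := (condLaw_eq_map F₁ h O xobs).1
  refine ofReal_integral_eq_lintegral_ofReal ?_
    (ae_of_all _ fun z => (jointDensity_pos F₁ h _ _).le)
  -- a function with a nonzero Bochner integral is integrable
  by_contra hni
  exact hpos.ne' (integral_undef hni)

/-- Splitting the coordinates into observed and missing ones preserves Lebesgue measure. -/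
theorem measurePreserving_split (O : Finset (Fin n)) (ι : Type) [Fintype ι] :
    MeasurePreserving (fun z : (Fin n → ℝ) × (ι → ℝ) =>
      ((fun i : {i // i ∈ O} => z.1 i), ((fun i : {i // i ∉ O} => z.1 i), z.2)))
      volume volume := by
  have h1 : MeasurePreserving (Prod.map
      (MeasurableEquiv.piEquivPiSubtypeProd (fun _ : Fin n => ℝ) (fun i => i ∈ O)) id)
      (volume : Measure ((Fin n → ℝ) × (ι → ℝ)))
      (volume : Measure ((({i // i ∈ O} → ℝ) × ({i // i ∉ O} → ℝ)) × (ι → ℝ))) := by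
    convert! (volume_preserving_piEquivPiSubtypeProd (fun _ : Fin n => ℝ) (fun i => i ∈ O)).prod
      (MeasurePreserving.id (volume : Measure (ι → ℝ)))
    rw [Measure.volume_eq_prod]
    congr!
  have h2 := (volume_preserving_prodAssoc (α₁ := {i // i ∈ O} → ℝ) (β₁ := {i // i ∉ O} → ℝ)
    (γ₁ := ι → ℝ))
  convert! h2.comp h1

theorem condDistrib_eq_condLaw (F₁ : Matrix (Fin n) (Fin n₁) ℝ) {θ : Params n n₁ n₂}
    (h : θ.Feasible) (O : Finset (Fin n)) :
    ∀ᵐ xobs ∂((modelLaw F₁ θ).map fun z (i : {i // i ∈ O}) => z.1 i),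
      condDistrib (fun z => ((fun i : {i // i ∉ O} => z.1 i), z.2))
        (fun z (i : {i // i ∈ O}) => z.1 i) (modelLaw F₁ θ) xobs
        = condLaw F₁ θ O xobs := by
  have hΦ := measurePreserving_split O (Fin n₁ ⊕ Fin n₂)
  set f : ({i // i ∈ O} → ℝ) × Latent n₁ n₂ O → ENNReal := fun p =>
    ENNReal.ofReal (jointDensity F₁ θ (merge O p.2.1 p.1) p.2.2) with hf
  have hfm : Measurable f := (continuous_jointDensity_merge F₁ θ O).measurable.ennreal_ofReal
  have hgm : Measurable fun a => ENNReal.ofReal (obsDensity F₁ θ O a) := by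
    simp only [lintegral_jointDensity_merge F₁ h O]
    exact hfm.lintegral_prod_right' (ν := (volume : Measure (Latent n₁ n₂ O)))
  have hqm : Measurable (Function.uncurry fun (a : {i // i ∈ O} → ℝ) (z : Latent n₁ n₂ O) =>
      f (a, z) / ENNReal.ofReal (obsDensity F₁ θ O a)) :=
    hfm.div (hgm.comp measurable_fst)
  let κ : Kernel ({i // i ∈ O} → ℝ) (Latent n₁ n₂ O) :=
    (Kernel.const _ (volume : Measure (Latent n₁ n₂ O))).withDensity
      fun a z => f (a, z) / ENNReal.ofReal (obsDensity F₁ θ O a)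
  have hκ : ∀ a, κ a = (volume : Measure (Latent n₁ n₂ O)).withDensity
      fun z => f (a, z) / ENNReal.ofReal (obsDensity F₁ θ O a) := fun a => by
    rw [Kernel.withDensity_apply _ hqm, Kernel.const_apply]
  have hκc : ∀ a, κ a = condLaw F₁ θ O a := fun a => by
    rw [hκ, condLaw]
    congr 1
    funext z
    rw [ENNReal.ofReal_div_of_pos (condLaw_eq_map F₁ h O a).1]
  have : IsMarkovKernel κ := ⟨fun a => by
    rw [hκc]; exact isProbabilityMeasure_condLaw F₁ h O a⟩
  have hmap : (modelLaw F₁ θ).map (fun z : (Fin n → ℝ) × (Fin n₁ ⊕ Fin n₂ → ℝ) =>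
      ((fun i : {i // i ∈ O} => z.1 i), ((fun i : {i // i ∉ O} => z.1 i), z.2)))
      = (volume.prod volume).withDensity f := by
    have hcomp : (fun z : (Fin n → ℝ) × (Fin n₁ ⊕ Fin n₂ → ℝ) =>
        ENNReal.ofReal (jointDensity F₁ θ z.1 z.2)) = f ∘ fun z =>
          ((fun i : {i // i ∈ O} => z.1 i), ((fun i : {i // i ∉ O} => z.1 i), z.2)) := by
      funext z
      simp only [hf, Function.comp]
      congr 2
      funext i
      rw [merge_apply]
      split_ifs <;> rfl
    rw [modelLaw_eq_withDensity F₁ h, hcomp, map_withDensity_comp _ hΦ.measurable hfm, hΦ.map_eq]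
    rfl
  have hmapX : (modelLaw F₁ θ).map (fun z (i : {i // i ∈ O}) => z.1 i)
      = ((volume.prod volume).withDensity f).map Prod.fst := by
    rw [← hmap, Measure.map_map measurable_fst hΦ.measurable]
    rfl
  have hmain := condDistrib_ae_eq_of_measure_eq_compProd (μ := modelLaw F₁ θ)
    (fun z (i : {i // i ∈ O}) => z.1 i)
    (Y := fun z => ((fun i : {i // i ∉ O} => z.1 i), z.2)) (by fun_prop) (κ := κ) (by
      rw [hmapX]
      exact hmap.trans (withDensity_prod_eq_compProd volume volume hfm
        (lintegral_jointDensity_merge F₁ h O)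
        (fun a => (ENNReal.ofReal_pos.2 (condLaw_eq_map F₁ h O a).1).ne')
        (fun a => ENNReal.ofReal_ne_top) κ hκ))
  filter_upwards [hmain] with a ha
  rw [ha, hκc]

/-! ### Conditional moments -/

theorem map_snd_shear {κ ι : Type} [Fintype κ] [DecidableEq κ] [Fintype ι] [DecidableEq ι]
    (F : Matrix κ ι ℝ) (a : ι → ℝ) (U : Matrix ι ι ℝ) (V : Matrix κ κ ℝ) :
    (((gaussianLaw a U).prod (gaussianLaw 0 V)).map fun z => (F *ᵥ z.1 + z.2, z.1)).map Prod.snd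
      = gaussianLaw a U := by
  rw [Measure.map_map measurable_snd (by fun_prop)]
  change Measure.map Prod.fst _ = _
  rw [Measure.map_fst_prod]
  simp

/-- First and second moments of `(F S + E, S)` for independent `S ∼ N(ŝ, G)` and `E ∼ N(0, D)`. -/
theorem moments_shear {κ ι : Type} [Fintype κ] [DecidableEq κ] [Fintype ι] [DecidableEq ι]
    (F : Matrix κ ι ℝ) (ŝ : ι → ℝ) {G : Matrix ι ι ℝ} (hG : G.PosSemidef) {D : Matrix κ κ ℝ}
    (hD : D.PosSemidef) {Q : Measure ((κ → ℝ) × (ι → ℝ))}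
    (hQ : Q = ((gaussianLaw ŝ G).prod (gaussianLaw 0 D)).map fun z => (F *ᵥ z.1 + z.2, z.1)) :
    (∀ a, MemLp (fun z => z.2 a) 2 Q) ∧
    (∀ m, MemLp (fun z => z.1 m) 2 Q) ∧
    (∀ a, ∫ z, z.2 a ∂Q = ŝ a) ∧
    (∀ a b, ∫ z, z.2 a * z.2 b ∂Q = G a b + ŝ a * ŝ b) ∧
    (∀ m, ∫ z, z.1 m ∂Q = (F *ᵥ ŝ) m) ∧
    (∀ m b, ∫ z, z.1 m * z.2 b ∂Q = (F * G) m b + (F *ᵥ ŝ) m * ŝ b) ∧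
    (∀ m l, ∫ z, z.1 m * z.1 l ∂Q
      = (F * G * Fᵀ + D) m l + (F *ᵥ ŝ) m * (F *ᵥ ŝ) l) := by
  rw [hQ]
  set P := (gaussianLaw ŝ G).prod (gaussianLaw 0 D) with hP
  have hint : ∀ {f g : (ι → ℝ) × (κ → ℝ) → ℝ}, MemLp f 2 P → MemLp g 2 P →
      Integrable (fun z => f z * g z) P := fun hf hg => hf.integrable_mul hg
  have hS : ∀ a, MemLp (fun z => z.1 a) 2 P := fun a =>
    (memLp_eval_gaussianLaw ŝ G a).comp_fst _
  have hE : ∀ m, MemLp (fun z => z.2 m) 2 P := fun m =>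
    (memLp_eval_gaussianLaw 0 D m).comp_snd _
  have hFS : ∀ m, MemLp (fun z : (ι → ℝ) × (κ → ℝ) =>
      ∑ a, F m a * z.1 a) 2 P := fun m =>
    memLp_finsetSum _ fun a _ => (hS a).const_mul (F m a)
  have iS : ∀ a, ∫ z, z.1 a ∂P = ŝ a := fun a => by
    rw [hP, integral_fun_fst (fun s : ι → ℝ => s a), integral_eval_gaussianLaw]
    simp
  have iSS : ∀ a b, ∫ z, z.1 a * z.1 b ∂P = G a b + ŝ a * ŝ b := fun a b => by
    rw [hP, integral_fun_fst (fun s : ι → ℝ => s a * s b),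
      integral_mul_gaussianLaw _ hG]
    simp
  have iE : ∀ m, ∫ z, z.2 m ∂P = 0 := fun m => by
    rw [hP, integral_fun_snd (fun s : κ → ℝ => s m), integral_eval_gaussianLaw]
    simp
  have iEE : ∀ m l, ∫ z, z.2 m * z.2 l ∂P = D m l := fun m l => by
    rw [hP, integral_fun_snd (fun s : κ → ℝ => s m * s l),
      integral_mul_gaussianLaw _ hD]
    simp
  have iSE : ∀ a m, ∫ z, z.1 a * z.2 m ∂P = 0 := fun a m => by
    rw [hP, integral_prod_mul (fun s : ι → ℝ => s a)
      (fun s : κ → ℝ => s m), integral_eval_gaussianLaw 0]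
    simp
  have iFS : ∀ m, ∫ z, ∑ a, F m a * z.1 a ∂P = (F *ᵥ ŝ) m := fun m => by
    rw [integral_finsetSum _ fun a _ => ((hS a).integrable one_le_two).const_mul _]
    exact Finset.sum_congr rfl fun a _ => by rw [integral_const_mul, iS]
  have iFSS : ∀ m b, ∫ z, (∑ a, F m a * z.1 a) * z.1 b ∂P
      = (F * G) m b + (F *ᵥ ŝ) m * ŝ b := fun m b => by
    simp only [Finset.sum_mul, mul_assoc]
    rw [integral_finsetSum _ fun a _ => (hint (hS a) (hS b)).const_mul _]
    simp only [integral_const_mul, iSS, mul_apply, mulVec, dotProduct, Finset.sum_mul, mul_add,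
      Finset.sum_add_distrib, mul_assoc]
  have iFSE : ∀ m l, ∫ z, (∑ a, F m a * z.1 a) * z.2 l ∂P = 0 := fun m l => by
    simp only [Finset.sum_mul, mul_assoc]
    rw [integral_finsetSum _ fun a _ => (hint (hS a) (hE l)).const_mul _]
    simp only [integral_const_mul, iSE, mul_zero, Finset.sum_const_zero]
  have iFSFS : ∀ m l, ∫ z, (∑ a, F m a * z.1 a) * (∑ a, F l a * z.1 a) ∂P
      = (F * G * Fᵀ) m l + (F *ᵥ ŝ) m * (F *ᵥ ŝ) l := fun m l => by
    have : ∀ z : (ι → ℝ) × (κ → ℝ),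
        (∑ a, F m a * z.1 a) * (∑ a, F l a * z.1 a)
          = ∑ b, F l b * ((∑ a, F m a * z.1 a) * z.1 b) := fun z => by
      rw [Finset.mul_sum]
      exact Finset.sum_congr rfl fun b _ => by ring
    simp only [this]
    rw [integral_finsetSum _ fun a _ => (hint (hFS m) (hS a)).const_mul _]
    simp only [integral_const_mul, iFSS]
    rw [mul_apply]
    simp only [transpose_apply, mul_add, Finset.sum_add_distrib]
    congr 1
    · exact Finset.sum_congr rfl fun b _ => mul_comm _ _
    · conv_rhs => rw [mulVec, mulVec, dotProduct, dotProduct, Finset.mul_sum]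
      exact Finset.sum_congr rfl fun b _ => by rw [mulVec, dotProduct]; ring
  have hT : Measurable fun z : (ι → ℝ) × (κ → ℝ) =>
    (F *ᵥ z.1 + z.2, z.1) := by fun_prop
  have hX : ∀ m, MemLp (fun z => (∑ a, F m a * z.1 a) + z.2 m) 2 P := fun m => (hFS m).add (hE m)
  have hmap : ∀ φ : (κ → ℝ) × (ι → ℝ) → ℝ, Continuous φ →
      ∫ z, φ z ∂(P.map fun z => (F *ᵥ z.1 + z.2, z.1)) = ∫ z, φ (F *ᵥ z.1 + z.2, z.1) ∂P :=
    fun φ hφ => integral_map hT.aemeasurable hφ.aestronglyMeasurable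
  refine ⟨fun a => ?_, fun m => ?_, fun a => ?_, fun a b => ?_, fun m => ?_, fun m b => ?_,
    fun m l => ?_⟩
  · exact (memLp_map_measure_iff (Continuous.aestronglyMeasurable (by fun_prop))
      hT.aemeasurable).2 (hS a)
  · exact (memLp_map_measure_iff (Continuous.aestronglyMeasurable (by fun_prop))
      hT.aemeasurable).2 (hX m)
  · rw [hmap _ (by fun_prop)]
    exact iS a
  · rw [hmap _ (by fun_prop)]
    exact iSS a b
  · rw [hmap _ (by fun_prop)]
    change ∫ z, (∑ a, F m a * z.1 a) + z.2 m ∂P = _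
    rw [integral_add ((hFS m).integrable one_le_two) ((hE m).integrable one_le_two), iFS, iE,
      add_zero]
  · rw [hmap _ (by fun_prop)]
    change ∫ z, ((∑ a, F m a * z.1 a) + z.2 m) * z.1 b ∂P = _
    simp only [add_mul]
    rw [integral_add (hint (hFS m) (hS b)) (hint (hE m) (hS b)), iFSS]
    have : ∫ z, z.2 m * z.1 b ∂P = 0 := by
      rw [← iSE b m]
      exact integral_congr_ae (ae_of_all _ fun z => mul_comm _ _)
    rw [this, add_zero]
  · rw [hmap _ (by fun_prop)]
    change ∫ z, ((∑ a, F m a * z.1 a) + z.2 m) * ((∑ a, F l a * z.1 a) + z.2 l) ∂P = _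
    have : ∀ z : (ι → ℝ) × (κ → ℝ),
        ((∑ a, F m a * z.1 a) + z.2 m) * ((∑ a, F l a * z.1 a) + z.2 l)
        = (∑ a, F m a * z.1 a) * (∑ a, F l a * z.1 a) + (∑ a, F m a * z.1 a) * z.2 l
          + ((∑ a, F l a * z.1 a) * z.2 m + z.2 m * z.2 l) := fun z => by ring
    simp only [this]
    have i1 := hint (hFS m) (hFS l)
    have i2 := hint (hFS m) (hE l)
    have i3 := hint (hFS l) (hE m)
    have i4 := hint (hE m) (hE l)
    rw [integral_add (i1.fun_add i2) (i3.fun_add i4), integral_add i1 i2, integral_add i3 i4, iFSFS,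
      iFSE, iFSE, iEE, Matrix.add_apply]
    ring

theorem condLaw_map_snd (F₁ : Matrix (Fin n) (Fin n₁) ℝ) {θ : Params n n₁ n₂}
    (h : θ.Feasible) (O : Finset (Fin n)) (xobs : {i // i ∈ O} → ℝ) :
    (condLaw F₁ θ O xobs).map Prod.snd = gaussianLaw (shat F₁ θ O xobs) (Gmat F₁ θ O) := by
  rw [(condLaw_eq_map F₁ h O xobs).2]
  exact map_snd_shear _ _ _ _

theorem memLp_merge_condLaw (F₁ : Matrix (Fin n) (Fin n₁) ℝ) {θ : Params n n₁ n₂}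
    (h : θ.Feasible) (O : Finset (Fin n)) (xobs : {i // i ∈ O} → ℝ) (i : Fin n) :
    MemLp (fun z => merge O z.1 xobs i) 2 (condLaw F₁ θ O xobs) := by
  have := isProbabilityMeasure_condLaw F₁ h O xobs
  obtain ⟨-, hX, -⟩ := moments_shear _ _ (h.posDef_Gmat F₁ O).posSemidef
    (h.posDef_Dmis O).posSemidef (condLaw_eq_map F₁ h O xobs).2
  simp only [merge_apply]
  split_ifs with hi
  · exact memLp_const _
  · exact hX _

theorem memLp_latent_condLaw (F₁ : Matrix (Fin n) (Fin n₁) ℝ) {θ : Params n n₁ n₂}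
    (h : θ.Feasible) (O : Finset (Fin n)) (xobs : {i // i ∈ O} → ℝ) (a : Fin n₁ ⊕ Fin n₂) :
    MemLp (fun z => z.2 a) 2 (condLaw F₁ θ O xobs) :=
  (moments_shear _ _ (h.posDef_Gmat F₁ O).posSemidef
    (h.posDef_Dmis O).posSemidef (condLaw_eq_map F₁ h O xobs).2).1 a

theorem permMatrix_transpose_mul_apply (O : Finset (Fin n)) {β : Type*}
    (M : Matrix ({i // i ∉ O} ⊕ {i // i ∈ O}) β ℝ) (i : Fin n) (b : β) :
    ((permMatrix O)ᵀ * M) i b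
      = if h : i ∈ O then M (Sum.inr ⟨i, h⟩) b else M (Sum.inl ⟨i, h⟩) b := by
  rw [← merge_apply O (fun m => M (Sum.inl m) b) (fun o => M (Sum.inr o) b) i, merge]
  change ∑ a, _ = ∑ a, _
  exact Finset.sum_congr rfl fun a _ => by cases a <;> rfl

theorem mul_permMatrix_apply (O : Finset (Fin n)) {β : Type*}
    (M : Matrix β ({i // i ∉ O} ⊕ {i // i ∈ O}) ℝ) (b : β) (j : Fin n) :
    (M * permMatrix O) b j
      = if h : j ∈ O then M b (Sum.inr ⟨j, h⟩) else M b (Sum.inl ⟨j, h⟩) := by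
  rw [← transpose_apply (M * permMatrix O), transpose_mul, permMatrix_transpose_mul_apply]
  rfl

theorem condSS_eq (F₁ : Matrix (Fin n) (Fin n₁) ℝ) {θ : Params n n₁ n₂}
    (h : θ.Feasible) (O : Finset (Fin n)) (xobs : {i // i ∈ O} → ℝ) :
    condSS F₁ θ O xobs
      = Gmat F₁ θ O + vecMulVec (shat F₁ θ O xobs) (shat F₁ θ O xobs) := by
  obtain ⟨-, -, -, hSS, -⟩ := moments_shear _ _ (h.posDef_Gmat F₁ O).posSemidef
    (h.posDef_Dmis O).posSemidef (condLaw_eq_map F₁ h O xobs).2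
  ext a b
  exact hSS a b

theorem condXS_eq (F₁ : Matrix (Fin n) (Fin n₁) ℝ) {θ : Params n n₁ n₂}
    (h : θ.Feasible) (O : Finset (Fin n)) (xobs : {i // i ∈ O} → ℝ) :
    condXS F₁ θ O xobs
      = vecMulVec (xhat F₁ θ O xobs) (shat F₁ θ O xobs)
        + (permMatrix O)ᵀ * (fromRows (Fmis F₁ θ O * Gmat F₁ θ O) 0 :
            Matrix ({i // i ∉ O} ⊕ {i // i ∈ O}) (Fin n₁ ⊕ Fin n₂) ℝ) := by
  obtain ⟨-, -, hS, -, -, hXS, -⟩ := moments_shear _ _ (h.posDef_Gmat F₁ O).posSemidef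
    (h.posDef_Dmis O).posSemidef (condLaw_eq_map F₁ h O xobs).2
  ext i b
  rw [Matrix.add_apply, permMatrix_transpose_mul_apply, vecMulVec_apply, xhat, merge_apply]
  simp only [condXS, of_apply, merge_apply]
  split_ifs with hi
  · rw [integral_const_mul, hS]
    simp
  · rw [hXS, fromRows_apply_inl, add_comm]

theorem condXX_eq (F₁ : Matrix (Fin n) (Fin n₁) ℝ) {θ : Params n n₁ n₂}
    (h : θ.Feasible) (O : Finset (Fin n)) (xobs : {i // i ∈ O} → ℝ) :
    condXX F₁ θ O xobs
      = vecMulVec (xhat F₁ θ O xobs) (xhat F₁ θ O xobs)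
        + (permMatrix O)ᵀ
          * (fromBlocks
              (Fmis F₁ θ O * Gmat F₁ θ O * (Fmis F₁ θ O)ᵀ + Dmis θ O) 0 0 0 :
              Matrix ({i // i ∉ O} ⊕ {i // i ∈ O}) ({i // i ∉ O} ⊕ {i // i ∈ O}) ℝ)
          * permMatrix O := by
  have := isProbabilityMeasure_condLaw F₁ h O xobs
  obtain ⟨-, -, -, -, hX, -, hXX⟩ := moments_shear _ _ (h.posDef_Gmat F₁ O).posSemidef
    (h.posDef_Dmis O).posSemidef (condLaw_eq_map F₁ h O xobs).2
  ext i j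
  rw [Matrix.add_apply, mul_permMatrix_apply, vecMulVec_apply, xhat, merge_apply, merge_apply]
  simp only [condXX, of_apply, merge_apply, permMatrix_transpose_mul_apply]
  by_cases hi : i ∈ O <;> by_cases hj : j ∈ O <;>
    simp only [hi, hj, dif_pos, dif_neg, not_false_eq_true]
  · simp
  · rw [integral_const_mul, hX]
    simp
  · rw [integral_mul_const, hX]
    simp
  · rw [hXX, fromBlocks_apply₁₁, add_comm]

/-! ### Minimization of the M-step objective -/

theorem one_add_log_le_div_add_log {d t : ℝ} (hd : 0 < d) (ht : 0 < t) :
    1 + Real.log d ≤ d / t + Real.log t := by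
  have := Real.log_le_sub_one_of_pos (div_pos hd ht)
  rw [Real.log_div hd.ne' ht.ne'] at this
  linarith

/-- The only possible minimizer of `t ↦ d / t + log t` on `(0, ∞)` is `d`; there is none when
`d ≤ 0`. -/
theorem eq_of_forall_div_add_log_le {d D : ℝ} (hD : 0 < D)
    (h : ∀ t, 0 < t → d / D + Real.log D ≤ d / t + Real.log t) : D = d := by
  rcases le_or_gt d 0 with hd | hd
  · -- halving `D` would decrease the value
    have h1 := h (D / 2) (half_pos hD)
    rw [Real.log_div hD.ne' two_ne_zero] at h1
    have h2 : d / (D / 2) = d / D + d / D := by field_simp; ring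
    have h3 : d / D ≤ 0 := div_nonpos_of_nonpos_of_nonneg hd hD.le
    have h4 := Real.log_pos one_lt_two
    linarith
  · by_contra hne
    have h1 := h d hd
    have h2 : d / D ≠ 1 := fun h => hne ((div_eq_one_iff_eq hD.ne').1 h).symm
    have h3 := Real.log_lt_sub_one_of_pos (div_pos hd hD) h2
    rw [Real.log_div hd.ne' hD.ne'] at h3
    rw [div_self hd.ne'] at h1
    linarith

/-- For positive definite `A`, `log det A ≤ tr A - |ι|`, with equality only at `A = 1`. -/
theorem log_det_le_trace_sub_card {ι : Type*} [Fintype ι] [DecidableEq ι] {A : Matrix ι ι ℝ}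
    (hA : A.PosDef) : Real.log A.det ≤ A.trace - Fintype.card ι ∧
      (A.trace - Fintype.card ι ≤ Real.log A.det → A = 1) := by
  set ev := hA.isHermitian.eigenvalues with hev
  have hpos : ∀ i, 0 < ev i := hA.eigenvalues_pos
  have hdet : Real.log A.det = ∑ i, Real.log (ev i) := by
    rw [hA.isHermitian.det_eq_prod_eigenvalues, ← Real.log_prod fun i _ => (hpos i).ne']
    simp [hev]
  have htr : A.trace - Fintype.card ι = ∑ i, (ev i - 1) := by
    rw [hA.isHermitian.trace_eq_sum_eigenvalues, Finset.sum_sub_distrib]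
    simp [hev]
  have hle : ∀ i ∈ Finset.univ, Real.log (ev i) ≤ ev i - 1 := fun i _ =>
    Real.log_le_sub_one_of_pos (hpos i)
  rw [hdet, htr]
  refine ⟨Finset.sum_le_sum hle, fun h => ?_⟩
  have heq := (Finset.sum_eq_sum_iff_of_le hle).1 (le_antisymm (Finset.sum_le_sum hle) h)
  have hone : ∀ i, ev i = 1 := by
    intro i
    by_contra hne
    exact (Real.log_lt_sub_one_of_pos (hpos i) hne).ne (heq i (Finset.mem_univ i))
  have hsp := hA.isHermitian.spectral_theorem
  have hd : diagonal ((RCLike.ofReal : ℝ → ℝ) ∘ hA.isHermitian.eigenvalues) = 1 := by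
    rw [← diagonal_one]
    congr 1
    funext i
    simpa [hev] using hone i
  rw [hd, map_one] at hsp
  exact hsp

open scoped MatrixOrder in
/-- `Ω ↦ tr (Ω⁻¹ S) + log det Ω` is uniquely minimized at `Ω = S` among positive definite
matrices. -/
theorem log_det_add_card_le {ι : Type*} [Fintype ι] [DecidableEq ι] {S Ω : Matrix ι ι ℝ}
    (hS : S.PosDef) (hΩ : Ω.PosDef) :
    (Fintype.card ι + Real.log S.det ≤ trace (Ω⁻¹ * S) + Real.log Ω.det) ∧
      (trace (Ω⁻¹ * S) + Real.log Ω.det ≤ Fintype.card ι + Real.log S.det → Ω = S) := by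
  obtain ⟨hBt, hB, hBdet⟩ := sqrt_posDef_spec hS
  generalize CFC.sqrt S = B at hBt hB hBdet
  have hBu : IsUnit B.det := isUnit_iff_ne_zero.2 hBdet
  have hA : (B * Ω⁻¹ * B).PosDef := by
    have hBh : B = Bᴴ := by rw [conjTranspose_eq_transpose_of_trivial, hBt]
    conv => arg 1; arg 2; rw [hBh]
    refine hΩ.inv.mul_mul_conjTranspose_same ?_
    exact vecMul_injective_of_isUnit ((isUnit_iff_isUnit_det _).2 hBu)
  have htr : (B * Ω⁻¹ * B).trace = trace (Ω⁻¹ * S) := by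
    rw [Matrix.mul_assoc, trace_mul_comm, Matrix.mul_assoc, hB]
  have hdet : Real.log (B * Ω⁻¹ * B).det = Real.log S.det - Real.log Ω.det := by
    rw [← Real.log_div hS.det_pos.ne' hΩ.det_pos.ne', ← hB, det_mul, det_mul, det_mul,
      det_nonsing_inv, Ring.inverse_eq_inv']
    congr 1
    field_simp
  obtain ⟨h1, h2⟩ := log_det_le_trace_sub_card hA
  rw [hdet, htr] at h1 h2
  refine ⟨by linarith, fun h => ?_⟩
  have h3 : B * Ω⁻¹ * B = 1 := h2 (by linarith)
  have h4 : Ω⁻¹ = S⁻¹ := by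
    rw [← hB, Matrix.mul_inv_rev]
    calc Ω⁻¹ = B⁻¹ * (B * Ω⁻¹ * B) * B⁻¹ := by
          rw [Matrix.mul_assoc, Matrix.mul_assoc (B * Ω⁻¹), mul_nonsing_inv _ hBu, Matrix.mul_one,
            ← Matrix.mul_assoc, nonsing_inv_mul _ hBu, Matrix.one_mul]
      _ = B⁻¹ * B⁻¹ := by rw [h3, Matrix.mul_one]
  rw [← nonsing_inv_nonsing_inv Ω ((isUnit_iff_isUnit_det _).1 hΩ.isUnit), h4,
    nonsing_inv_nonsing_inv S ((isUnit_iff_isUnit_det _).1 hS.isUnit)]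

/-- The M-step objective, up to an additive constant, as a function of `θ` and of matrices `V`, `C`,
`S₂₂`, `S₁₁` in the places of `Σ̃`, `C̃_xs`, `C_ss,22`, `C_ss,11`. -/
noncomputable def mObjective (V : Matrix (Fin n) (Fin n) ℝ) (C : Matrix (Fin n) (Fin n₂) ℝ)
    (S₂₂ : Matrix (Fin n₂) (Fin n₂) ℝ) (S₁₁ : Matrix (Fin n₁) (Fin n₁) ℝ)
    (θ : Params n n₁ n₂) : ℝ :=
  trace (θ.D⁻¹ * (V - (2 : ℝ) • (C * θ.F₂ᵀ) + θ.F₂ * S₂₂ * θ.F₂ᵀ)) + Real.log θ.D.det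
    + trace (θ.Ω⁻¹ * S₁₁) + Real.log θ.Ω.det

/-- Completing the square in each row of `F₂`. -/
theorem diag_residual_eq {V : Matrix (Fin n) (Fin n) ℝ} {C : Matrix (Fin n) (Fin n₂) ℝ}
    {S₂₂ : Matrix (Fin n₂) (Fin n₂) ℝ} (hS : S₂₂.PosDef) (F : Matrix (Fin n) (Fin n₂) ℝ)
    (i : Fin n) :
    (V - (2 : ℝ) • (C * Fᵀ) + F * S₂₂ * Fᵀ) i i
      = (V - C * S₂₂⁻¹ * Cᵀ) i i
        + (F - C * S₂₂⁻¹) i ⬝ᵥ (S₂₂ *ᵥ (F - C * S₂₂⁻¹) i) := by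
  have hu : IsUnit S₂₂.det := (isUnit_iff_isUnit_det _).1 hS.isUnit
  have hsym : S₂₂ᵀ = S₂₂ := by
    have := hS.isHermitian
    rwa [Matrix.IsHermitian, conjTranspose_eq_transpose_of_trivial] at this
  have hrow : (F - C * S₂₂⁻¹) i ⬝ᵥ (S₂₂ *ᵥ (F - C * S₂₂⁻¹) i)
      = ((F - C * S₂₂⁻¹) * S₂₂ * (F - C * S₂₂⁻¹)ᵀ) i i := by
    rw [Matrix.mul_assoc, mul_apply]
    refine Finset.sum_congr rfl fun a _ => ?_
    rw [mul_apply]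
    rfl
  have hcross : (F * Cᵀ) i i = (C * Fᵀ) i i := by
    rw [← transpose_apply (F * Cᵀ), transpose_mul, transpose_transpose]
  have hexp : (F - C * S₂₂⁻¹) * S₂₂ * (F - C * S₂₂⁻¹)ᵀ
      = F * S₂₂ * Fᵀ - F * Cᵀ - C * Fᵀ + C * S₂₂⁻¹ * Cᵀ := by
    have h1 : (F - C * S₂₂⁻¹) * S₂₂ = F * S₂₂ - C := by
      rw [Matrix.sub_mul, Matrix.mul_assoc C, nonsing_inv_mul _ hu, Matrix.mul_one]
    have h2 : (F - C * S₂₂⁻¹)ᵀ = Fᵀ - S₂₂⁻¹ * Cᵀ := by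
      rw [transpose_sub, transpose_mul, transpose_nonsing_inv, hsym]
    rw [h1, h2, Matrix.sub_mul, Matrix.mul_sub, Matrix.mul_sub, Matrix.mul_assoc F S₂₂ (S₂₂⁻¹ * Cᵀ),
      ← Matrix.mul_assoc S₂₂, mul_nonsing_inv _ hu, Matrix.one_mul, Matrix.mul_assoc C]
    abel
  rw [hrow, hexp]
  simp only [Matrix.add_apply, Matrix.sub_apply, Matrix.smul_apply, smul_eq_mul, hcross]
  ring

theorem trace_inv_mul_of_isDiag {ι : Type*} [Fintype ι] [DecidableEq ι] {D : Matrix ι ι ℝ}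
    (hD : D.IsDiag) (h : ∀ i, 0 < D i i) (M : Matrix ι ι ℝ) :
    trace (D⁻¹ * M) = ∑ i, M i i / D i i := by
  rw [inv_of_isDiag hD h]
  simp only [trace, diag_apply, diagonal_mul]
  exact Finset.sum_congr rfl fun i _ => by rw [div_eq_inv_mul]

theorem log_det_of_isDiag {ι : Type*} [Fintype ι] [DecidableEq ι] {D : Matrix ι ι ℝ}
    (hD : D.IsDiag) (h : ∀ i, 0 < D i i) : Real.log D.det = ∑ i, Real.log (D i i) := by
  conv_lhs => rw [← hD.diagonal_diag]
  rw [det_diagonal]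
  exact Real.log_prod fun i _ => (h i).ne'

theorem mObjective_eq_sum {V : Matrix (Fin n) (Fin n) ℝ} {C : Matrix (Fin n) (Fin n₂) ℝ}
    {S₂₂ : Matrix (Fin n₂) (Fin n₂) ℝ} (hS : S₂₂.PosDef) (S₁₁ : Matrix (Fin n₁) (Fin n₁) ℝ)
    {θ : Params n n₁ n₂} (hθ : θ.Feasible) :
    mObjective V C S₂₂ S₁₁ θ
      = ∑ i, ((V - C * S₂₂⁻¹ * Cᵀ) i i / θ.D i i + Real.log (θ.D i i))
        + ∑ i, ((θ.F₂ - C * S₂₂⁻¹) i ⬝ᵥ (S₂₂ *ᵥ (θ.F₂ - C * S₂₂⁻¹) i)) / θ.D i i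
        + (trace (θ.Ω⁻¹ * S₁₁) + Real.log θ.Ω.det) := by
  rw [mObjective, trace_inv_mul_of_isDiag hθ.2.1 hθ.2.2, log_det_of_isDiag hθ.2.1 hθ.2.2,
    ← Finset.sum_add_distrib, ← Finset.sum_add_distrib, add_assoc]
  congr 1
  refine Finset.sum_congr rfl fun i _ => ?_
  rw [diag_residual_eq hS, add_div]
  ring

/-- A feasible parameter minimizes this objective exactly when it is given by the closed
form. -/
theorem isMinOn_mObjective_iff {V : Matrix (Fin n) (Fin n) ℝ} {C : Matrix (Fin n) (Fin n₂) ℝ}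
    {S₂₂ : Matrix (Fin n₂) (Fin n₂) ℝ} (hS : S₂₂.PosDef) {S₁₁ : Matrix (Fin n₁) (Fin n₁) ℝ}
    (hS₁ : S₁₁.PosDef) {θ : Params n n₁ n₂} (hθ : θ.Feasible) :
    IsMinOn (mObjective V C S₂₂ S₁₁) {θ' | θ'.Feasible} θ ↔
      θ = ⟨C * S₂₂⁻¹, S₁₁, diagonal (diag (V - C * S₂₂⁻¹ * Cᵀ))⟩ := by
  have hq : ∀ v : Fin n₂ → ℝ, 0 ≤ v ⬝ᵥ (S₂₂ *ᵥ v) := fun v => by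
    simpa using hS.posSemidef.dotProduct_mulVec_nonneg v
  constructor
  · intro hmin
    have hcmp : ∀ θ' : Params n n₁ n₂, θ'.Feasible →
        mObjective V C S₂₂ S₁₁ θ ≤ mObjective V C S₂₂ S₁₁ θ' := fun θ' h' => hmin h'
    have hF : θ.F₂ = C * S₂₂⁻¹ := by
      have h1 := hcmp ⟨C * S₂₂⁻¹, θ.Ω, θ.D⟩ hθ
      rw [mObjective_eq_sum hS S₁₁ hθ, mObjective_eq_sum (θ := ⟨C * S₂₂⁻¹, θ.Ω, θ.D⟩) hS S₁₁ hθ,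
        add_le_add_iff_right, add_le_add_iff_left] at h1
      have h2 : ∀ i, ((θ.F₂ - C * S₂₂⁻¹) i ⬝ᵥ (S₂₂ *ᵥ (θ.F₂ - C * S₂₂⁻¹) i)) / θ.D i i = 0 := by
        have hnn : ∀ i ∈ Finset.univ,
            0 ≤ ((θ.F₂ - C * S₂₂⁻¹) i ⬝ᵥ (S₂₂ *ᵥ (θ.F₂ - C * S₂₂⁻¹) i)) / θ.D i i :=
          fun i _ => div_nonneg (hq _) (hθ.2.2 i).le
        have h3 : ∑ i, ((θ.F₂ - C * S₂₂⁻¹) i ⬝ᵥ (S₂₂ *ᵥ (θ.F₂ - C * S₂₂⁻¹) i)) / θ.D i i = 0 := by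
          refine le_antisymm (h1.trans_eq ?_) (Finset.sum_nonneg hnn)
          refine Finset.sum_eq_zero fun i _ => ?_
          have : (C * S₂₂⁻¹ - C * S₂₂⁻¹) i = 0 := by rw [sub_self]; rfl
          rw [this, zero_dotProduct, zero_div]
        exact fun i => (Finset.sum_eq_zero_iff_of_nonneg hnn).1 h3 i (Finset.mem_univ i)
      rw [← sub_eq_zero]
      funext i
      by_contra hne
      have h4 := hS.dotProduct_mulVec_pos hne
      rw [star_trivial] at h4
      exact (div_pos h4 (hθ.2.2 i)).ne' (h2 i)
    have hΩ : θ.Ω = S₁₁ := by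
      have hf : Params.Feasible (⟨θ.F₂, S₁₁, θ.D⟩ : Params n n₁ n₂) := ⟨hS₁, hθ.2⟩
      have h1 := hcmp _ hf
      rw [mObjective_eq_sum hS S₁₁ hθ, mObjective_eq_sum hS S₁₁ hf, add_le_add_iff_left] at h1
      refine (log_det_add_card_le hS₁ hθ.1).2 (h1.trans_eq ?_)
      rw [nonsing_inv_mul _ ((isUnit_iff_isUnit_det _).1 hS₁.isUnit), trace_one]
    have hD : ∀ i, θ.D i i = (V - C * S₂₂⁻¹ * Cᵀ) i i := by
      intro i
      refine eq_of_forall_div_add_log_le (hθ.2.2 i) fun t ht => ?_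
      -- change only the `i`-th diagonal entry of `D`
      have hf : Params.Feasible (⟨θ.F₂, θ.Ω, diagonal (Function.update (diag θ.D) i t)⟩ :
          Params n n₁ n₂) := by
        refine ⟨hθ.1, isDiag_diagonal _, fun j => ?_⟩
        change 0 < diagonal (Function.update (diag θ.D) i t) j j
        rw [diagonal_apply_eq]
        rcases eq_or_ne j i with rfl | hj
        · rwa [Function.update_self]
        · rw [Function.update_of_ne hj]
          exact hθ.2.2 j
      have h1 := hcmp _ hf
      rw [mObjective_eq_sum hS S₁₁ hθ, mObjective_eq_sum hS S₁₁ hf, add_le_add_iff_right] at h1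
      have h2 : ∀ d : Fin n → ℝ,
          ∑ j, ((θ.F₂ - C * S₂₂⁻¹) j ⬝ᵥ (S₂₂ *ᵥ (θ.F₂ - C * S₂₂⁻¹) j)) / d j = 0 := by
        refine fun d => Finset.sum_eq_zero fun j _ => ?_
        have : (θ.F₂ - C * S₂₂⁻¹) j = 0 := by rw [hF, sub_self]; rfl
        rw [this, zero_dotProduct, zero_div]
      rw [h2 fun j => θ.D j j, h2 fun j => diagonal (Function.update (diag θ.D) i t) j j,
        add_zero, add_zero] at h1
      simp only [diagonal_apply_eq] at h1
      rw [← Finset.add_sum_erase _ _ (Finset.mem_univ i),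
        ← Finset.add_sum_erase (Finset.univ : Finset (Fin n)) _ (Finset.mem_univ i)] at h1
      have h3 : ∑ j ∈ Finset.univ.erase i,
            ((V - C * S₂₂⁻¹ * Cᵀ) j j / Function.update (diag θ.D) i t j
                + Real.log (Function.update (diag θ.D) i t j))
          = ∑ j ∈ Finset.univ.erase i,
            ((V - C * S₂₂⁻¹ * Cᵀ) j j / θ.D j j + Real.log (θ.D j j)) := by
        refine Finset.sum_congr rfl fun j hj => ?_
        rw [Function.update_of_ne (Finset.ne_of_mem_erase hj)]
        rfl
      rw [h3, add_le_add_iff_right, Function.update_self] at h1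
      exact h1
    have hD' : θ.D = diagonal (diag (V - C * S₂₂⁻¹ * Cᵀ)) := by
      rw [← hθ.2.1.diagonal_diag]
      congr 1
      exact funext hD
    exact Params.ext hF hΩ hD'
  · rintro hθe θ' (hθ' : θ'.Feasible)
    change mObjective V C S₂₂ S₁₁ θ ≤ mObjective V C S₂₂ S₁₁ θ'
    have hF : θ.F₂ = C * S₂₂⁻¹ := by rw [hθe]
    have hΩ : θ.Ω = S₁₁ := by rw [hθe]
    have hD : ∀ i, (V - C * S₂₂⁻¹ * Cᵀ) i i = θ.D i i := fun i => by
      conv_rhs => rw [hθe]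
      exact (diagonal_apply_eq _ _).symm
    rw [mObjective_eq_sum hS S₁₁ hθ, mObjective_eq_sum hS S₁₁ hθ']
    refine add_le_add (add_le_add (Finset.sum_le_sum fun i _ => ?_)
      (Finset.sum_le_sum fun i _ => ?_)) ?_
    · rw [hD, div_self (hθ.2.2 i).ne']
      exact one_add_log_le_div_add_log (hθ.2.2 i) (hθ'.2.2 i)
    · have h2 : (θ.F₂ - C * S₂₂⁻¹) i = 0 := by rw [hF, sub_self]; rfl
      rw [h2, zero_dotProduct, zero_div]
      exact div_nonneg (hq _) (hθ'.2.2 i).le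
    · rw [hΩ, nonsing_inv_mul _ ((isUnit_iff_isUnit_det _).1 hS₁.isUnit), trace_one]
      exact (log_det_add_card_le hS₁ hθ'.1).1

/-! ### The M-step objective in terms of second moments -/

theorem neg_two_mul_log_gaussianDensity {ι : Type} [Fintype ι] [DecidableEq ι] (μ : ι → ℝ)
    {V : Matrix ι ι ℝ} (hV : V.PosDef) (x : ι → ℝ) :
    -2 * Real.log (gaussianDensity μ V x) = Fintype.card ι * Real.log (2 * Real.pi)
      + Real.log V.det + (x - μ) ⬝ᵥ (V⁻¹ *ᵥ (x - μ)) := by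
  have hd := hV.det_pos
  have h2 : (2 * Real.pi) ^ Fintype.card ι ≠ 0 := by positivity
  rw [gaussianDensity, Real.log_mul (by positivity) (Real.exp_pos _).ne', Real.log_inv,
    Real.log_sqrt (by positivity), Real.log_exp, Real.log_mul h2 hd.ne', Real.log_pow]
  ring

theorem Params.det_Otilde (θ : Params n n₁ n₂) : θ.Otilde.det = θ.Ω.det := by
  rw [Params.Otilde, det_fromBlocks_zero₂₁, det_one, mul_one]

theorem Params.Feasible.inv_Otilde {θ : Params n n₁ n₂} (h : θ.Feasible) :
    θ.Otilde⁻¹ = fromBlocks θ.Ω⁻¹ 0 0 1 := by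
  refine inv_eq_right_inv ?_
  rw [Params.Otilde, fromBlocks_multiply,
    mul_nonsing_inv _ ((isUnit_iff_isUnit_det _).1 h.1.isUnit)]
  simp

theorem neg_two_mul_log_jointDensity (F₁ : Matrix (Fin n) (Fin n₁) ℝ) {θ : Params n n₁ n₂}
    (h : θ.Feasible) (x : Fin n → ℝ) (s : Fin n₁ ⊕ Fin n₂ → ℝ) :
    -2 * Real.log (jointDensity F₁ θ x s)
      = ((n + (n₁ + n₂) : ℝ) * Real.log (2 * Real.pi) + Real.log θ.D.det + Real.log θ.Ω.det)
        + ∑ i, (x i - (θ.Ftilde F₁ *ᵥ s) i) ^ 2 / θ.D i i + s ⬝ᵥ (θ.Otilde⁻¹ *ᵥ s) := by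
  rw [jointDensity, Real.log_mul (gaussianDensity_pos _ h.posDef_D _).ne'
    (gaussianDensity_pos _ h.posDef_Otilde _).ne', mul_add,
    neg_two_mul_log_gaussianDensity _ h.posDef_D, neg_two_mul_log_gaussianDensity _ h.posDef_Otilde,
    dotProduct_inv_mulVec_of_isDiag h.2.1 h.2.2, Params.det_Otilde, sub_zero]
  simp only [Fintype.card_fin, Fintype.card_sum, Pi.sub_apply, Nat.cast_add]
  ring

/-- The conditional second moment of `X - F S`. -/
theorem integral_sq_residual (F₁ : Matrix (Fin n) (Fin n₁) ℝ) {θ : Params n n₁ n₂}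
    (h : θ.Feasible) (O : Finset (Fin n)) (xobs : {i // i ∈ O} → ℝ)
    (F : Matrix (Fin n) (Fin n₁ ⊕ Fin n₂) ℝ) (i : Fin n) :
    Integrable (fun z => (merge O z.1 xobs i - (F *ᵥ z.2) i) ^ 2) (condLaw F₁ θ O xobs) ∧
    ∫ z, (merge O z.1 xobs i - (F *ᵥ z.2) i) ^ 2 ∂(condLaw F₁ θ O xobs)
      = (condXX F₁ θ O xobs - (2 : ℝ) • (condXS F₁ θ O xobs * Fᵀ)
          + F * condSS F₁ θ O xobs * Fᵀ) i i := by
  have hX := memLp_merge_condLaw F₁ h O xobs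
  have hS := memLp_latent_condLaw F₁ h O xobs
  have hXX : Integrable (fun z => merge O z.1 xobs i * merge O z.1 xobs i) (condLaw F₁ θ O xobs) :=
    (hX i).integrable_mul (hX i)
  have hXS : ∀ a, Integrable (fun z => F i a * (merge O z.1 xobs i * z.2 a))
      (condLaw F₁ θ O xobs) := fun a => ((hX i).integrable_mul (hS a)).const_mul _
  have hSS : ∀ a b, Integrable (fun z => F i a * F i b * (z.2 a * z.2 b))
      (condLaw F₁ θ O xobs) := fun a b => ((hS a).integrable_mul (hS b)).const_mul _
  have hexp : ∀ z : Latent n₁ n₂ O, (merge O z.1 xobs i - (F *ᵥ z.2) i) ^ 2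
      = merge O z.1 xobs i * merge O z.1 xobs i
        - 2 * ∑ a, F i a * (merge O z.1 xobs i * z.2 a)
        + ∑ b, ∑ a, F i a * F i b * (z.2 a * z.2 b) := by
    intro z
    have h1 : (F *ᵥ z.2) i = ∑ a, F i a * z.2 a := rfl
    have h2 : ∑ a, F i a * (merge O z.1 xobs i * z.2 a)
        = merge O z.1 xobs i * ∑ a, F i a * z.2 a := by
      rw [Finset.mul_sum]
      exact Finset.sum_congr rfl fun a _ => by ring
    have h3 : ∑ b, ∑ a, F i a * F i b * (z.2 a * z.2 b)
        = (∑ a, F i a * z.2 a) * ∑ b, F i b * z.2 b := by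
      rw [Finset.mul_sum]
      refine Finset.sum_congr rfl fun b _ => ?_
      rw [Finset.sum_mul]
      exact Finset.sum_congr rfl fun a _ => by ring
    rw [h1, h2, h3]
    ring
  have i1 := integrable_finsetSum Finset.univ fun a _ => hXS a
  have i2 := integrable_finsetSum Finset.univ fun b _ =>
    integrable_finsetSum Finset.univ fun a _ => hSS a b
  have i3 : Integrable (fun z => merge O z.1 xobs i * merge O z.1 xobs i
      - 2 * ∑ a, F i a * (merge O z.1 xobs i * z.2 a)) (condLaw F₁ θ O xobs) :=
    hXX.sub (i1.const_mul 2)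
  simp only [hexp]
  refine ⟨i3.add i2, ?_⟩
  rw [integral_add i3 i2, integral_sub hXX (i1.const_mul 2),
    integral_const_mul, integral_finsetSum _ fun a _ => hXS a,
    integral_finsetSum _ fun b _ => integrable_finsetSum Finset.univ fun a _ => hSS a b]
  simp only [integral_finsetSum _ fun a _ => hSS a _, integral_const_mul, Matrix.add_apply,
    Matrix.sub_apply, Matrix.smul_apply, mul_apply, transpose_apply, smul_eq_mul]
  congr 1
  · congr 2
    exact Finset.sum_congr rfl fun a _ => mul_comm _ _
  · refine Finset.sum_congr rfl fun b _ => ?_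
    rw [Finset.sum_mul]
    exact Finset.sum_congr rfl fun a _ => by
      rw [mul_right_comm]
      rfl

theorem integral_quadratic_condLaw (F₁ : Matrix (Fin n) (Fin n₁) ℝ) {θ : Params n n₁ n₂}
    (h : θ.Feasible) (O : Finset (Fin n)) (xobs : {i // i ∈ O} → ℝ)
    (P : Matrix (Fin n₁ ⊕ Fin n₂) (Fin n₁ ⊕ Fin n₂) ℝ) :
    Integrable (fun z => z.2 ⬝ᵥ (P *ᵥ z.2)) (condLaw F₁ θ O xobs) ∧
    ∫ z, z.2 ⬝ᵥ (P *ᵥ z.2) ∂(condLaw F₁ θ O xobs) = trace (P * condSS F₁ θ O xobs) := by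
  have hS := memLp_latent_condLaw F₁ h O xobs
  have hSS : ∀ a b, Integrable (fun z => P a b * (z.2 b * z.2 a)) (condLaw F₁ θ O xobs) :=
    fun a b => ((hS b).integrable_mul (hS a)).const_mul _
  have hexp : ∀ z : Latent n₁ n₂ O, z.2 ⬝ᵥ (P *ᵥ z.2)
      = ∑ a, ∑ b, P a b * (z.2 b * z.2 a) := by
    intro z
    refine Finset.sum_congr rfl fun a _ => ?_
    rw [mulVec, dotProduct, Finset.mul_sum]
    exact Finset.sum_congr rfl fun b _ => by ring
  simp only [hexp]
  refine ⟨integrable_finsetSum _ fun a _ => integrable_finsetSum _ fun b _ => hSS a b, ?_⟩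
  rw [integral_finsetSum _ fun a _ => integrable_finsetSum _ fun b _ => hSS a b]
  refine Finset.sum_congr rfl fun a _ => ?_
  rw [integral_finsetSum _ fun b _ => hSS a b, diag_apply, mul_apply]
  simp only [integral_const_mul]
  rfl

theorem trace_inv_Otilde_mul {θ : Params n n₁ n₂} (h : θ.Feasible)
    (M : Matrix (Fin n₁ ⊕ Fin n₂) (Fin n₁ ⊕ Fin n₂) ℝ) :
    trace (θ.Otilde⁻¹ * M) = trace (θ.Ω⁻¹ * M.toBlocks₁₁) + trace M.toBlocks₂₂ := by
  conv_lhs => rw [h.inv_Otilde, ← fromBlocks_toBlocks M, fromBlocks_multiply]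
  simp [trace, Fintype.sum_sum_type]

theorem integral_neg_two_mul_log_jointDensity (F₁ : Matrix (Fin n) (Fin n₁) ℝ)
    {θk θ : Params n n₁ n₂} (hk : θk.Feasible) (h : θ.Feasible) (O : Finset (Fin n))
    (xobs : {i // i ∈ O} → ℝ) :
    Integrable (fun z => -2 * Real.log (jointDensity F₁ θ (merge O z.1 xobs) z.2))
      (condLaw F₁ θk O xobs) ∧
    ∫ z, -2 * Real.log (jointDensity F₁ θ (merge O z.1 xobs) z.2) ∂(condLaw F₁ θk O xobs)
      = ((n + (n₁ + n₂) : ℝ) * Real.log (2 * Real.pi) + Real.log θ.D.det + Real.log θ.Ω.det)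
        + trace (θ.D⁻¹ * (condXX F₁ θk O xobs
            - (2 : ℝ) • (condXS F₁ θk O xobs * (θ.Ftilde F₁)ᵀ)
            + θ.Ftilde F₁ * condSS F₁ θk O xobs * (θ.Ftilde F₁)ᵀ))
        + trace (θ.Otilde⁻¹ * condSS F₁ θk O xobs) := by
  have := isProbabilityMeasure_condLaw F₁ hk O xobs
  have hR := integral_sq_residual F₁ hk O xobs (θ.Ftilde F₁)
  have hQ := integral_quadratic_condLaw F₁ hk O xobs θ.Otilde⁻¹
  simp only [neg_two_mul_log_jointDensity F₁ h]
  have i1 := integrable_finsetSum Finset.univ fun i _ => (hR i).1.div_const (θ.D i i)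
  have i0 := integrable_const (μ := condLaw F₁ θk O xobs)
    ((n + (n₁ + n₂) : ℝ) * Real.log (2 * Real.pi) + Real.log θ.D.det + Real.log θ.Ω.det)
  refine ⟨(i0.add i1).add hQ.1, ?_⟩
  rw [integral_add (i0.fun_add i1) hQ.1, integral_add i0 i1, hQ.2, integral_const,
    integral_finsetSum _ fun i _ => (hR i).1.div_const (θ.D i i),
    trace_inv_mul_of_isDiag h.2.1 h.2.2]
  simp only [integral_div, (hR _).2, probReal_univ, one_smul]

/-- Splitting the factors into the known and the added block turns the residual second moments into
the form that defines `Σ̃` and `C̃_xs`. -/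
theorem residual_apply_eq (F₁ : Matrix (Fin n) (Fin n₁) ℝ) (F₂ : Matrix (Fin n) (Fin n₂) ℝ)
    (C : Matrix (Fin n) (Fin n) ℝ) (Cxs : Matrix (Fin n) (Fin n₁ ⊕ Fin n₂) ℝ)
    {Css : Matrix (Fin n₁ ⊕ Fin n₂) (Fin n₁ ⊕ Fin n₂) ℝ} (hsym : Cssᵀ = Css) (i : Fin n) :
    (C - (2 : ℝ) • (Cxs * (fromCols F₁ F₂)ᵀ) + fromCols F₁ F₂ * Css * (fromCols F₁ F₂)ᵀ) i i
      = (sigmaTilde F₁ C Cxs Css - (2 : ℝ) • (cTilde F₁ Cxs Css * F₂ᵀ)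
          + F₂ * Css.toBlocks₂₂ * F₂ᵀ) i i := by
  have h21 : Css.toBlocks₂₁ = Css.toBlocks₁₂ᵀ := by
    conv_lhs => rw [← hsym]
    rfl
  have hcross : (F₂ * Css.toBlocks₂₁ * F₁ᵀ) i i = (F₁ * Css.toBlocks₁₂ * F₂ᵀ) i i := by
    rw [← transpose_apply (F₂ * Css.toBlocks₂₁ * F₁ᵀ), h21, transpose_mul, transpose_mul,
      transpose_transpose, transpose_transpose, Matrix.mul_assoc]
  have h1 : Cxs * (fromCols F₁ F₂)ᵀ = Cxs.toCols₁ * F₁ᵀ + Cxs.toCols₂ * F₂ᵀ := by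
    conv_lhs => rw [← fromCols_toCols Cxs, transpose_fromCols, fromCols_mul_fromRows]
  have h2 : fromCols F₁ F₂ * Css * (fromCols F₁ F₂)ᵀ
      = (F₁ * Css.toBlocks₁₁ + F₂ * Css.toBlocks₂₁) * F₁ᵀ
        + (F₁ * Css.toBlocks₁₂ + F₂ * Css.toBlocks₂₂) * F₂ᵀ := by
    conv_lhs => rw [← fromBlocks_toBlocks Css, fromCols_mul_fromBlocks, transpose_fromCols,
      fromCols_mul_fromRows]
  rw [h1, h2, sigmaTilde, cTilde]
  simp only [Matrix.add_mul, Matrix.sub_mul, Matrix.add_apply, Matrix.sub_apply,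
    Matrix.smul_apply, smul_eq_mul, hcross]
  ring

theorem condSS_transpose (F₁ : Matrix (Fin n) (Fin n₁) ℝ) (θ : Params n n₁ n₂)
    (O : Finset (Fin n)) (xobs : {i // i ∈ O} → ℝ) :
    (condSS F₁ θ O xobs)ᵀ = condSS F₁ θ O xobs := by
  ext a b
  simp only [transpose_apply, condSS, of_apply, mul_comm]

theorem aggSS_transpose (F₁ : Matrix (Fin n) (Fin n₁) ℝ) (w : Fin T → ℝ)
    (O : Fin T → Finset (Fin n)) (x : (τ : Fin T) → {i // i ∈ O τ} → ℝ) (θ : Params n n₁ n₂) :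
    (aggSS F₁ w O x θ)ᵀ = aggSS F₁ w O x θ := by
  simp only [aggSS, transpose_sum, transpose_smul, condSS_transpose]

/-- Residual second moments are linear in the second moments of `(X, S)`. -/
theorem agg_residual_eq_sum (F₁ : Matrix (Fin n) (Fin n₁) ℝ) (w : Fin T → ℝ)
    (O : Fin T → Finset (Fin n)) (x : (τ : Fin T) → {i // i ∈ O τ} → ℝ) (θ : Params n n₁ n₂)
    (F : Matrix (Fin n) (Fin n₁ ⊕ Fin n₂) ℝ) :
    aggXX F₁ w O x θ - (2 : ℝ) • (aggXS F₁ w O x θ * Fᵀ) + F * aggSS F₁ w O x θ * Fᵀ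
      = ∑ τ, w τ • (condXX F₁ θ (O τ) (x τ) - (2 : ℝ) • (condXS F₁ θ (O τ) (x τ) * Fᵀ)
          + F * condSS F₁ θ (O τ) (x τ) * Fᵀ) := by
  simp only [aggXX, aggXS, aggSS, Matrix.sum_mul, Matrix.mul_sum, Matrix.smul_mul, Matrix.mul_smul,
    smul_add, smul_sub, Finset.sum_add_distrib, Finset.sum_sub_distrib, Finset.smul_sum]
  simp only [smul_comm (2 : ℝ)]

theorem emObjective_eq_mObjective (F₁ : Matrix (Fin n) (Fin n₁) ℝ) {w : Fin T → ℝ}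
    (hw1 : ∑ τ, w τ = 1) (O : Fin T → Finset (Fin n)) (x : (τ : Fin T) → {i // i ∈ O τ} → ℝ)
    {θk θ : Params n n₁ n₂} (hk : θk.Feasible) (h : θ.Feasible) :
    emObjective F₁ w O x θk θ
      = mObjective (sigmaTilde F₁ (aggXX F₁ w O x θk) (aggXS F₁ w O x θk) (aggSS F₁ w O x θk))
          (cTilde F₁ (aggXS F₁ w O x θk) (aggSS F₁ w O x θk)) (aggSS F₁ w O x θk).toBlocks₂₂
          (aggSS F₁ w O x θk).toBlocks₁₁ θ
        + ((n + (n₁ + n₂) : ℝ) * Real.log (2 * Real.pi)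
          + trace (aggSS F₁ w O x θk).toBlocks₂₂) := by
  have h1 : trace (θ.D⁻¹ * (sigmaTilde F₁ (aggXX F₁ w O x θk) (aggXS F₁ w O x θk)
        (aggSS F₁ w O x θk)
        - (2 : ℝ) • (cTilde F₁ (aggXS F₁ w O x θk) (aggSS F₁ w O x θk) * θ.F₂ᵀ)
        + θ.F₂ * (aggSS F₁ w O x θk).toBlocks₂₂ * θ.F₂ᵀ))
      = ∑ τ, w τ * trace (θ.D⁻¹ * (condXX F₁ θk (O τ) (x τ)
            - (2 : ℝ) • (condXS F₁ θk (O τ) (x τ) * (θ.Ftilde F₁)ᵀ)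
            + θ.Ftilde F₁ * condSS F₁ θk (O τ) (x τ) * (θ.Ftilde F₁)ᵀ)) := by
    have h2 : ∀ c : ℝ, ∀ M : Matrix (Fin n) (Fin n) ℝ,
        c * trace (θ.D⁻¹ * M) = trace (θ.D⁻¹ * (c • M)) := fun c M => by
      rw [Matrix.mul_smul, trace_smul, smul_eq_mul]
    simp only [h2]
    rw [← trace_sum, ← Matrix.mul_sum, ← agg_residual_eq_sum, trace_inv_mul_of_isDiag h.2.1 h.2.2,
      trace_inv_mul_of_isDiag h.2.1 h.2.2]
    refine Finset.sum_congr rfl fun i _ => ?_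
    rw [Params.Ftilde, residual_apply_eq _ _ _ _ (aggSS_transpose F₁ w O x θk)]
  have h3 : trace (θ.Ω⁻¹ * (aggSS F₁ w O x θk).toBlocks₁₁) + trace (aggSS F₁ w O x θk).toBlocks₂₂
      = ∑ τ, w τ * trace (θ.Otilde⁻¹ * condSS F₁ θk (O τ) (x τ)) := by
    rw [← trace_inv_Otilde_mul h, aggSS, Matrix.mul_sum, trace_sum]
    simp only [Matrix.mul_smul, trace_smul, smul_eq_mul]
  rw [mObjective, h1, emObjective]
  simp only [(integral_neg_two_mul_log_jointDensity F₁ hk h _ _).2, mul_add,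
    Finset.sum_add_distrib]
  rw [← h3, ← Finset.sum_mul, ← Finset.sum_mul, ← Finset.sum_mul, hw1]
  ring

/-! ### Positivity of the closed-form noise variances -/

theorem dotProduct_vecMulVec_mulVec {ι : Type*} [Fintype ι] (r u : ι → ℝ) :
    r ⬝ᵥ (vecMulVec u u *ᵥ r) = (r ⬝ᵥ u) ^ 2 := by
  simp only [dotProduct, mulVec, vecMulVec_apply, sq]
  rw [Finset.sum_mul_sum]
  refine Finset.sum_congr rfl fun a _ => ?_
  rw [Finset.mul_sum]
  exact Finset.sum_congr rfl fun b _ => by ring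

theorem posDef_aggSS (F₁ : Matrix (Fin n) (Fin n₁) ℝ) {w : Fin T → ℝ} (hw : ∀ τ, 0 ≤ w τ)
    (hw1 : ∑ τ, w τ = 1) (O : Fin T → Finset (Fin n)) (x : (τ : Fin T) → {i // i ∈ O τ} → ℝ)
    {θ : Params n n₁ n₂} (h : θ.Feasible) : (aggSS F₁ w O x θ).PosDef := by
  have hpos : ∀ τ, ∀ v : Fin n₁ ⊕ Fin n₂ → ℝ, v ≠ 0 →
      0 < v ⬝ᵥ (condSS F₁ θ (O τ) (x τ) *ᵥ v) := by
    intro τ v hv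
    rw [condSS_eq F₁ h, add_mulVec, dotProduct_add, dotProduct_vecMulVec_mulVec]
    have := (h.posDef_Gmat F₁ (O τ)).dotProduct_mulVec_pos hv
    rw [star_trivial] at this
    positivity
  refine PosDef.of_dotProduct_mulVec_pos ?_ fun {v} hv => ?_
  · rw [Matrix.IsHermitian, conjTranspose_eq_transpose_of_trivial, aggSS_transpose]
  · obtain ⟨τ, -, hτ⟩ : ∃ τ ∈ Finset.univ, 0 < w τ := by
      refine Finset.exists_lt_of_sum_lt ?_
      simp [hw1]
    rw [star_trivial, aggSS, sum_mulVec, dotProduct_sum]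
    simp only [smul_mulVec, dotProduct_smul, smul_eq_mul]
    exact Finset.sum_pos' (fun σ _ => mul_nonneg (hw σ) (hpos σ v hv).le)
      ⟨τ, Finset.mem_univ τ, mul_pos hτ (hpos τ v hv)⟩

theorem mul_mul_transpose_apply_self {κ ι : Type*} [Fintype ι] (F : Matrix κ ι ℝ)
    (S : Matrix ι ι ℝ) (i : κ) : (F * S * Fᵀ) i i = F i ⬝ᵥ (S *ᵥ F i) := by
  rw [Matrix.mul_assoc, mul_apply]
  refine Finset.sum_congr rfl fun a _ => ?_
  rw [mul_apply]
  rfl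

/-- For an observed asset `X_i` is the constant `x_i`, so the residual `x_i - F S` has conditional
second moment `(x_i - F ŝ)² + F G Fᵀ`. -/
theorem cond_residual_of_mem (F₁ : Matrix (Fin n) (Fin n₁) ℝ) {θ : Params n n₁ n₂}
    (h : θ.Feasible) (O : Finset (Fin n)) (xobs : {i // i ∈ O} → ℝ)
    (F : Matrix (Fin n) (Fin n₁ ⊕ Fin n₂) ℝ) {i : Fin n} (hi : i ∈ O) :
    (condXX F₁ θ O xobs - (2 : ℝ) • (condXS F₁ θ O xobs * Fᵀ) + F * condSS F₁ θ O xobs * Fᵀ) i i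
      = (xobs ⟨i, hi⟩ - F i ⬝ᵥ shat F₁ θ O xobs) ^ 2 + F i ⬝ᵥ (Gmat F₁ θ O *ᵥ F i) := by
  have hXX : condXX F₁ θ O xobs i i = xobs ⟨i, hi⟩ ^ 2 := by
    rw [condXX_eq F₁ h, Matrix.add_apply, mul_permMatrix_apply, vecMulVec_apply, xhat, merge_apply]
    simp only [permMatrix_transpose_mul_apply, hi, dif_pos, fromBlocks_apply₂₂, Matrix.zero_apply,
      add_zero, sq]
  have hXS : ∀ b, condXS F₁ θ O xobs i b = xobs ⟨i, hi⟩ * shat F₁ θ O xobs b := by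
    intro b
    rw [condXS_eq F₁ h, Matrix.add_apply, permMatrix_transpose_mul_apply, vecMulVec_apply, xhat,
      merge_apply]
    simp only [hi, dif_pos, fromRows_apply_inr, Matrix.zero_apply, add_zero]
  have hcross : (condXS F₁ θ O xobs * Fᵀ) i i = xobs ⟨i, hi⟩ * (F i ⬝ᵥ shat F₁ θ O xobs) := by
    rw [mul_apply, dotProduct, Finset.mul_sum]
    refine Finset.sum_congr rfl fun b _ => ?_
    rw [hXS, transpose_apply]
    ring
  rw [Matrix.add_apply, Matrix.sub_apply, Matrix.smul_apply, mul_mul_transpose_apply_self, hXX,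
    hcross, condSS_eq F₁ h, add_mulVec, dotProduct_add, dotProduct_vecMulVec_mulVec, smul_eq_mul]
  ring

/-- For a missing asset the residual second moment is at least the noise variance `D_ii`, whatever
the loadings `F`. -/
theorem cond_residual_pos_of_notMem (F₁ : Matrix (Fin n) (Fin n₁) ℝ) {θ : Params n n₁ n₂}
    (h : θ.Feasible) (O : Finset (Fin n)) (xobs : {i // i ∈ O} → ℝ)
    (F : Matrix (Fin n) (Fin n₁ ⊕ Fin n₂) ℝ) {i : Fin n} (hi : i ∉ O) :
    0 < (condXX F₁ θ O xobs - (2 : ℝ) • (condXS F₁ θ O xobs * Fᵀ)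
      + F * condSS F₁ θ O xobs * Fᵀ) i i := by
  set g : Fin n₁ ⊕ Fin n₂ → ℝ := Fmis F₁ θ O ⟨i, hi⟩ with hg
  set G := Gmat F₁ θ O with hG
  set ŝ := shat F₁ θ O xobs with hŝ
  have hGp := h.posDef_Gmat F₁ O
  rw [← hG] at hGp
  have hGt : Gᵀ = G := by
    have := hGp.isHermitian
    rwa [Matrix.IsHermitian, conjTranspose_eq_transpose_of_trivial] at this
  have hXX : condXX F₁ θ O xobs i i = (g ⬝ᵥ ŝ) ^ 2 + (g ⬝ᵥ (G *ᵥ g) + θ.D i i) := by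
    rw [condXX_eq F₁ h, Matrix.add_apply, mul_permMatrix_apply, vecMulVec_apply, xhat, merge_apply]
    simp only [permMatrix_transpose_mul_apply, hi, dif_neg, not_false_eq_true, fromBlocks_apply₁₁,
      Matrix.add_apply, mul_mul_transpose_apply_self]
    rw [sq]
    rfl
  have hXS : ∀ b, condXS F₁ θ O xobs i b = (g ⬝ᵥ ŝ) * ŝ b + (G *ᵥ g) b := by
    intro b
    rw [condXS_eq F₁ h, Matrix.add_apply, permMatrix_transpose_mul_apply, vecMulVec_apply, xhat,
      merge_apply]
    simp only [hi, dif_neg, not_false_eq_true, fromRows_apply_inl]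
    have : (Fmis F₁ θ O * G) ⟨i, hi⟩ b = (G *ᵥ g) b := by
      conv_rhs => rw [← hGt, mulVec_transpose]
      rfl
    rw [this]
    rfl
  have hcross : (condXS F₁ θ O xobs * Fᵀ) i i = (g ⬝ᵥ ŝ) * (F i ⬝ᵥ ŝ) + F i ⬝ᵥ (G *ᵥ g) := by
    have h1 : F i ⬝ᵥ ŝ = ∑ b, F i b * ŝ b := rfl
    have h2 : F i ⬝ᵥ (G *ᵥ g) = ∑ b, F i b * (G *ᵥ g) b := rfl
    rw [mul_apply, h1, h2, Finset.mul_sum, ← Finset.sum_add_distrib]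
    refine Finset.sum_congr rfl fun b _ => ?_
    rw [hXS, transpose_apply]
    ring
  have hval : (condXX F₁ θ O xobs - (2 : ℝ) • (condXS F₁ θ O xobs * Fᵀ)
      + F * condSS F₁ θ O xobs * Fᵀ) i i
      = (g ⬝ᵥ ŝ - F i ⬝ᵥ ŝ) ^ 2 + (g - F i) ⬝ᵥ (G *ᵥ (g - F i)) + θ.D i i := by
    rw [Matrix.add_apply, Matrix.sub_apply, Matrix.smul_apply, mul_mul_transpose_apply_self, hXX,
      hcross, condSS_eq F₁ h, add_mulVec, dotProduct_add, dotProduct_vecMulVec_mulVec, smul_eq_mul]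
    simp only [mulVec_sub, dotProduct_sub, sub_dotProduct,
      dotProduct_mulVec_comm_of_symm hGt g (F i)]
    ring
  rw [hval]
  have h1 : 0 ≤ (g - F i) ⬝ᵥ (G *ᵥ (g - F i)) := by
    simpa using hGp.posSemidef.dotProduct_mulVec_nonneg (g - F i)
  have h2 := h.2.2 i
  positivity

/-- The aggregated residual second moment with loadings `[F₁ F₂]` is the closed-form `D_ii` plus a
quadratic form in the deviation of the `i`-th row of `F₂` from the closed form. In particular
`D_ii` is its value at the optimal loadings. -/
theorem sum_cond_residual_eq_mStep_D_add (F₁ : Matrix (Fin n) (Fin n₁) ℝ) {w : Fin T → ℝ}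
    (hw : ∀ τ, 0 ≤ w τ) (hw1 : ∑ τ, w τ = 1)
    (O : Fin T → Finset (Fin n)) (x : (τ : Fin T) → {i // i ∈ O τ} → ℝ)
    {θ : Params n n₁ n₂} (h : θ.Feasible) (F₂ : Matrix (Fin n) (Fin n₂) ℝ) (i : Fin n) :
    ∑ τ, w τ * (condXX F₁ θ (O τ) (x τ)
        - (2 : ℝ) • (condXS F₁ θ (O τ) (x τ) * (fromCols F₁ F₂)ᵀ)
        + fromCols F₁ F₂ * condSS F₁ θ (O τ) (x τ) * (fromCols F₁ F₂)ᵀ) i i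
      = (mStep F₁ (aggXX F₁ w O x θ) (aggXS F₁ w O x θ) (aggSS F₁ w O x θ)).D i i
        + (F₂ - (mStep F₁ (aggXX F₁ w O x θ) (aggXS F₁ w O x θ) (aggSS F₁ w O x θ)).F₂) i ⬝ᵥ
          ((aggSS F₁ w O x θ).toBlocks₂₂ *ᵥ
            (F₂ - (mStep F₁ (aggXX F₁ w O x θ) (aggXS F₁ w O x θ) (aggSS F₁ w O x θ)).F₂) i) := by
  have h22 : (aggSS F₁ w O x θ).toBlocks₂₂.PosDef :=
    (posDef_aggSS F₁ hw hw1 O x h).submatrix Sum.inr_injective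
  have h1 := agg_residual_eq_sum F₁ w O x θ (fromCols F₁ F₂)
  have h2 := congrFun (congrFun h1 i) i
  rw [Matrix.sum_apply] at h2
  simp only [Matrix.smul_apply, smul_eq_mul] at h2
  rw [residual_apply_eq _ _ _ _ (aggSS_transpose F₁ w O x θ), diag_residual_eq h22] at h2
  rw [← h2]
  simp only [mStep, diagonal_apply_eq, diag_apply]

theorem mStep_feasible_iff (F₁ : Matrix (Fin n) (Fin n₁) ℝ) {w : Fin T → ℝ} (hw : ∀ τ, 0 ≤ w τ)
    (hw1 : ∑ τ, w τ = 1) (O : Fin T → Finset (Fin n)) (x : (τ : Fin T) → {i // i ∈ O τ} → ℝ)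
    {θ : Params n n₁ n₂} (h : θ.Feasible) :
    (mStep F₁ (aggXX F₁ w O x θ) (aggXS F₁ w O x θ) (aggSS F₁ w O x θ)).Feasible ↔
      ∀ i, (∃ j, F₁ i j ≠ 0) ∨ ∃ τ, 0 < w τ ∧ ∀ h : i ∈ O τ, x τ ⟨i, h⟩ ≠ 0 := by
  have hSS := posDef_aggSS F₁ hw hw1 O x h
  have hD := sum_cond_residual_eq_mStep_D_add F₁ hw hw1 O x h
  set θ' := mStep F₁ (aggXX F₁ w O x θ) (aggXS F₁ w O x θ) (aggSS F₁ w O x θ) with hθ'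
  have hbase : θ'.Feasible ↔ ∀ i, 0 < θ'.D i i :=
    ⟨fun h => h.2.2, fun h => ⟨hSS.submatrix Sum.inl_injective, isDiag_diagonal _, h⟩⟩
  rw [hbase]
  refine forall_congr' fun i => ⟨fun hi => ?_, fun hi => ?_⟩
  · -- with zero loadings and zero observed returns the residual moment vanishes
    by_contra! hcon
    obtain ⟨hF, hx⟩ := hcon
    have hz := hD 0 i
    set Z : Matrix (Fin n) (Fin n₁ ⊕ Fin n₂) ℝ := fromCols F₁ 0 with hZ
    have hr : Z i = 0 := by
      funext a
      cases a with
      | inl a => exact hF a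
      | inr a => rfl
    have hsum : ∑ τ, w τ * (condXX F₁ θ (O τ) (x τ)
        - (2 : ℝ) • (condXS F₁ θ (O τ) (x τ) * Zᵀ)
        + Z * condSS F₁ θ (O τ) (x τ) * Zᵀ) i i = 0 := by
      refine Finset.sum_eq_zero fun τ _ => ?_
      rcases (hw τ).eq_or_lt with hτ | hτ
      · rw [← hτ, zero_mul]
      · obtain ⟨hm, hxm⟩ := hx τ hτ
        rw [cond_residual_of_mem F₁ h _ _ _ hm, hr, hxm]
        simp
    rw [hsum] at hz
    have hq : 0 ≤ ((0 : Matrix (Fin n) (Fin n₂) ℝ) - θ'.F₂) i ⬝ᵥ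
        ((aggSS F₁ w O x θ).toBlocks₂₂ *ᵥ ((0 : Matrix (Fin n) (Fin n₂) ℝ) - θ'.F₂) i) := by
      have h22 : (aggSS F₁ w O x θ).toBlocks₂₂.PosDef := hSS.submatrix Sum.inr_injective
      simpa only [star_trivial] using h22.posSemidef.dotProduct_mulVec_nonneg
        (((0 : Matrix (Fin n) (Fin n₂) ℝ) - θ'.F₂) i)
    linarith
  · have hz := hD θ'.F₂ i
    have h0 : (θ'.F₂ - θ'.F₂) i = 0 := by rw [sub_self]; rfl
    rw [h0, zero_dotProduct, add_zero] at hz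
    rw [← hz]
    have hnn : ∀ τ, 0 ≤ (condXX F₁ θ (O τ) (x τ)
        - (2 : ℝ) • (condXS F₁ θ (O τ) (x τ) * (fromCols F₁ θ'.F₂)ᵀ)
        + fromCols F₁ θ'.F₂ * condSS F₁ θ (O τ) (x τ) * (fromCols F₁ θ'.F₂)ᵀ) i i := fun τ => by
      rw [← (integral_sq_residual F₁ h (O τ) (x τ) _ i).2]
      exact integral_nonneg fun z => sq_nonneg _
    -- it suffices to find a time of positive weight with a positive residual moment
    suffices hex : ∃ τ, 0 < w τ ∧ 0 < (condXX F₁ θ (O τ) (x τ)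
        - (2 : ℝ) • (condXS F₁ θ (O τ) (x τ) * (fromCols F₁ θ'.F₂)ᵀ)
        + fromCols F₁ θ'.F₂ * condSS F₁ θ (O τ) (x τ) * (fromCols F₁ θ'.F₂)ᵀ) i i by
      obtain ⟨τ, hτ, hpos⟩ := hex
      exact Finset.sum_pos' (fun σ _ => mul_nonneg (hw σ) (hnn σ))
        ⟨τ, Finset.mem_univ τ, mul_pos hτ hpos⟩
    by_cases hr : fromCols F₁ θ'.F₂ i = 0
    · rcases hi with ⟨j, hj⟩ | ⟨τ, hτ, hx⟩
      · exact absurd (congrFun hr (Sum.inl j)) hj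
      · refine ⟨τ, hτ, ?_⟩
        by_cases hm : i ∈ O τ
        · rw [cond_residual_of_mem F₁ h _ _ _ hm, hr, zero_dotProduct, zero_dotProduct, sub_zero,
            add_zero]
          have := hx hm
          positivity
        · exact cond_residual_pos_of_notMem F₁ h _ _ _ hm
    · obtain ⟨τ, -, hτ⟩ : ∃ τ ∈ Finset.univ, 0 < w τ := by
        refine Finset.exists_lt_of_sum_lt ?_
        simp [hw1]
      refine ⟨τ, hτ, ?_⟩
      by_cases hm : i ∈ O τ
      · rw [cond_residual_of_mem F₁ h _ _ _ hm]
        have := (h.posDef_Gmat F₁ (O τ)).dotProduct_mulVec_pos hr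
        rw [star_trivial] at this
        positivity
      · exact cond_residual_pos_of_notMem F₁ h _ _ _ hm

/-! ### The fully observed case -/

section FullyObserved

variable (F₁ : Matrix (Fin n) (Fin n₁) ℝ) (θ : Params n n₁ n₂)

theorem Fobs_transpose_mul_inv_Dobs_univ :
    (Fobs F₁ θ Finset.univ)ᵀ * (Dobs θ Finset.univ)⁻¹
      = ((θ.Ftilde F₁)ᵀ * θ.D⁻¹).submatrix id Subtype.val := by
  let e : {i : Fin n // i ∈ Finset.univ} ≃ Fin n := Equiv.subtypeUnivEquiv Finset.mem_univ
  have h1 : Dobs θ Finset.univ = θ.D.submatrix e e := rfl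
  have h2 : (Fobs F₁ θ Finset.univ)ᵀ = (θ.Ftilde F₁)ᵀ.submatrix id e := rfl
  rw [h1, h2, inv_submatrix_equiv, submatrix_mul_equiv]
  rfl

theorem Gmat_univ : Gmat F₁ θ Finset.univ
    = ((θ.Ftilde F₁)ᵀ * θ.D⁻¹ * θ.Ftilde F₁ + θ.Otilde⁻¹)⁻¹ := by
  let e : {i : Fin n // i ∈ Finset.univ} ≃ Fin n := Equiv.subtypeUnivEquiv Finset.mem_univ
  have h1 : Fobs F₁ θ Finset.univ = (θ.Ftilde F₁).submatrix e id := rfl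
  have h2 : ((θ.Ftilde F₁)ᵀ * θ.D⁻¹).submatrix id (Subtype.val : {i // i ∈ Finset.univ} → Fin n)
      = ((θ.Ftilde F₁)ᵀ * θ.D⁻¹).submatrix id e := rfl
  rw [Gmat, Fobs_transpose_mul_inv_Dobs_univ, h2, h1, submatrix_mul_equiv, submatrix_id_id]

theorem shat_univ (y : Fin n → ℝ) : shat F₁ θ Finset.univ (fun i => y i)
    = (((θ.Ftilde F₁)ᵀ * θ.D⁻¹ * θ.Ftilde F₁ + θ.Otilde⁻¹)⁻¹ * (θ.Ftilde F₁)ᵀ * θ.D⁻¹) *ᵥ y := by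
  let e : {i : Fin n // i ∈ Finset.univ} ≃ Fin n := Equiv.subtypeUnivEquiv Finset.mem_univ
  have h2 : ((θ.Ftilde F₁)ᵀ * θ.D⁻¹).submatrix id (Subtype.val : {i // i ∈ Finset.univ} → Fin n)
      *ᵥ (fun i : {i // i ∈ Finset.univ} => y i) = ((θ.Ftilde F₁)ᵀ * θ.D⁻¹) *ᵥ y := by
    funext a
    exact e.sum_comp fun j => ((θ.Ftilde F₁)ᵀ * θ.D⁻¹) a j * y j
  rw [shat, Lmat, Matrix.mul_assoc, Fobs_transpose_mul_inv_Dobs_univ, ← mulVec_mulVec, h2,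
    mulVec_mulVec, Gmat_univ, ← Matrix.mul_assoc]

theorem agg_univ {θ : Params n n₁ n₂} (h : θ.Feasible) {w : Fin T → ℝ} (hw1 : ∑ τ, w τ = 1)
    (y : Fin T → Fin n → ℝ) (C : Matrix (Fin n) (Fin n) ℝ)
    (G : Matrix (Fin n₁ ⊕ Fin n₂) (Fin n₁ ⊕ Fin n₂) ℝ) (L : Matrix (Fin n₁ ⊕ Fin n₂) (Fin n) ℝ)
    (hC : C = ∑ τ, w τ • vecMulVec (y τ) (y τ))
    (hG : G = ((θ.Ftilde F₁)ᵀ * θ.D⁻¹ * θ.Ftilde F₁ + θ.Otilde⁻¹)⁻¹)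
    (hL : L = G * (θ.Ftilde F₁)ᵀ * θ.D⁻¹) :
    aggXX F₁ w (fun _ => Finset.univ) (fun τ i => y τ i) θ = C ∧
    aggXS F₁ w (fun _ => Finset.univ) (fun τ i => y τ i) θ = C * Lᵀ ∧
    aggSS F₁ w (fun _ => Finset.univ) (fun τ i => y τ i) θ = G + L * C * Lᵀ := by
  have hs : ∀ τ, shat F₁ θ Finset.univ (fun i => y τ i) = L *ᵥ y τ := fun τ => by
    rw [shat_univ, hL, hG]
  have hxh : ∀ τ, xhat F₁ θ Finset.univ (fun i => y τ i) = y τ := fun τ => by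
    funext i
    rw [xhat, merge_apply, dif_pos (Finset.mem_univ i)]
  refine ⟨?_, ?_, ?_⟩
  · rw [aggXX, hC]
    refine Finset.sum_congr rfl fun τ _ => ?_
    rw [condXX_eq F₁ h, hxh]
    congr 1
    ext i j
    rw [Matrix.add_apply, mul_permMatrix_apply, dif_pos (Finset.mem_univ j),
      permMatrix_transpose_mul_apply, dif_pos (Finset.mem_univ i)]
    simp
  · rw [aggXS, hC, Matrix.sum_mul]
    refine Finset.sum_congr rfl fun τ _ => ?_
    rw [condXS_eq F₁ h, hxh, hs, Matrix.smul_mul, vecMulVec_mul, vecMul_transpose]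
    congr 1
    ext i j
    rw [Matrix.add_apply, permMatrix_transpose_mul_apply, dif_pos (Finset.mem_univ i)]
    simp
  · have h1 : ∀ τ, condSS F₁ θ Finset.univ (fun i => y τ i)
        = G + L * vecMulVec (y τ) (y τ) * Lᵀ := fun τ => by
      rw [condSS_eq F₁ h, hs, Gmat_univ, ← hG, mul_vecMulVec, vecMulVec_mul, vecMul_transpose]
    simp only [aggSS, h1, smul_add, Finset.sum_add_distrib]
    rw [← Finset.sum_smul, hw1, one_smul, hC, Matrix.mul_sum, Matrix.sum_mul]
    simp only [Matrix.mul_smul, Matrix.smul_mul]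

end FullyObserved

end FactorEM

theorem mainTheorem5 (n n₁ n₂ T : ℕ) (F₁ : Matrix (Fin n) (Fin n₁) ℝ)
    (w : Fin T → ℝ) (hw : ∀ τ, 0 ≤ w τ) (hw1 : ∑ τ, w τ = 1)
    (O : Fin T → Finset (Fin n)) (x : (τ : Fin T) → {i // i ∈ O τ} → ℝ)
    (θk : Params n n₁ n₂) (hθk : θk.Feasible) :
    -- `p_θ` is the joint density of `(X, S)`
    (∀ θ : Params n n₁ n₂, θ.Feasible →
      modelLaw F₁ θ =
        volume.withDensity fun z => ENNReal.ofReal (jointDensity F₁ θ z.1 z.2)) ∧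
    -- E-step: `condLaw` is the conditional law of `(X_mis, S)` given `X_obs`
    (∀ τ, ∀ᵐ xobs ∂((modelLaw F₁ θk).map fun z (i : {i // i ∈ O τ}) => z.1 i),
      condDistrib (fun z => ((fun i : {i // i ∉ O τ} => z.1 i), z.2))
        (fun z (i : {i // i ∈ O τ}) => z.1 i) (modelLaw F₁ θk) xobs
        = condLaw F₁ θk (O τ) xobs) ∧
    -- E-step: conditional law of `S` and second moments
    (∀ τ,
      IsProbabilityMeasure (condLaw F₁ θk (O τ) (x τ)) ∧
      (Gmat F₁ θk (O τ)).PosDef ∧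
      (condLaw F₁ θk (O τ) (x τ)).map Prod.snd
        = gaussianLaw (shat F₁ θk (O τ) (x τ)) (Gmat F₁ θk (O τ)) ∧
      (∀ a b, Integrable (fun z => z.2 a * z.2 b) (condLaw F₁ θk (O τ) (x τ))) ∧
      (∀ i b, Integrable (fun z => merge (O τ) z.1 (x τ) i * z.2 b)
        (condLaw F₁ θk (O τ) (x τ))) ∧
      (∀ i j, Integrable (fun z => merge (O τ) z.1 (x τ) i * merge (O τ) z.1 (x τ) j)
        (condLaw F₁ θk (O τ) (x τ))) ∧
      condSS F₁ θk (O τ) (x τ)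
        = Gmat F₁ θk (O τ)
          + vecMulVec (shat F₁ θk (O τ) (x τ)) (shat F₁ θk (O τ) (x τ)) ∧
      condXS F₁ θk (O τ) (x τ)
        = vecMulVec (xhat F₁ θk (O τ) (x τ)) (shat F₁ θk (O τ) (x τ))
          + (permMatrix (O τ))ᵀ
            * (fromRows (Fmis F₁ θk (O τ) * Gmat F₁ θk (O τ)) 0 :
                Matrix ({i // i ∉ O τ} ⊕ {i // i ∈ O τ}) (Fin n₁ ⊕ Fin n₂) ℝ) ∧
      condXX F₁ θk (O τ) (x τ)
        = vecMulVec (xhat F₁ θk (O τ) (x τ)) (xhat F₁ θk (O τ) (x τ))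
          + (permMatrix (O τ))ᵀ
            * (fromBlocks
                (Fmis F₁ θk (O τ) * Gmat F₁ θk (O τ) * (Fmis F₁ θk (O τ))ᵀ + Dmis θk (O τ)) 0 0 0 :
                Matrix ({i // i ∉ O τ} ⊕ {i // i ∈ O τ}) ({i // i ∉ O τ} ⊕ {i // i ∈ O τ}) ℝ)
            * permMatrix (O τ)) ∧
    -- M-step: the objective, up to a constant that does not depend on `θ`
    (∀ θ : Params n n₁ n₂, θ.Feasible → ∀ τ,
      Integrable (fun z => -2 * Real.log (jointDensity F₁ θ (merge (O τ) z.1 (x τ)) z.2))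
        (condLaw F₁ θk (O τ) (x τ))) ∧
    (∃ c : ℝ, ∀ θ : Params n n₁ n₂, θ.Feasible →
      emObjective F₁ w O x θk θ =
        trace (θ.D⁻¹ *
          (sigmaTilde F₁ (aggXX F₁ w O x θk) (aggXS F₁ w O x θk) (aggSS F₁ w O x θk)
            - (2 : ℝ) • (cTilde F₁ (aggXS F₁ w O x θk) (aggSS F₁ w O x θk) * θ.F₂ᵀ)
            + θ.F₂ * (aggSS F₁ w O x θk).toBlocks₂₂ * θ.F₂ᵀ))
        + Real.log θ.D.det
        + trace (θ.Ω⁻¹ * (aggSS F₁ w O x θk).toBlocks₁₁)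
        + Real.log θ.Ω.det + c) ∧
    -- M-step: closed form of the minimizer
    (aggSS F₁ w O x θk).toBlocks₂₂.PosDef ∧
    (∀ θ : Params n n₁ n₂, θ.Feasible →
      (IsMinOn (emObjective F₁ w O x θk) {θ' | θ'.Feasible} θ ↔
        θ = mStep F₁ (aggXX F₁ w O x θk) (aggXS F₁ w O x θk) (aggSS F₁ w O x θk))) ∧
    ((mStep F₁ (aggXX F₁ w O x θk) (aggXS F₁ w O x θk) (aggSS F₁ w O x θk)).Feasible ↔
      ∀ i, (∃ j, F₁ i j ≠ 0) ∨ ∃ τ, 0 < w τ ∧ ∀ h : i ∈ O τ, x τ ⟨i, h⟩ ≠ 0) ∧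
    -- in the fully observed case the aggregated moments are `C`, `C Lᵀ` and `G + L C Lᵀ`
    (∀ (y : Fin T → Fin n → ℝ) (C : Matrix (Fin n) (Fin n) ℝ)
        (G : Matrix (Fin n₁ ⊕ Fin n₂) (Fin n₁ ⊕ Fin n₂) ℝ)
        (L : Matrix (Fin n₁ ⊕ Fin n₂) (Fin n) ℝ),
      C = ∑ τ, w τ • vecMulVec (y τ) (y τ) →
      G = ((θk.Ftilde F₁)ᵀ * θk.D⁻¹ * θk.Ftilde F₁ + θk.Otilde⁻¹)⁻¹ →
      L = G * (θk.Ftilde F₁)ᵀ * θk.D⁻¹ →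
      aggXX F₁ w (fun _ => Finset.univ) (fun τ i => y τ i) θk = C ∧
      aggXS F₁ w (fun _ => Finset.univ) (fun τ i => y τ i) θk = C * Lᵀ ∧
      aggSS F₁ w (fun _ => Finset.univ) (fun τ i => y τ i) θk = G + L * C * Lᵀ) := by
  have hSS := posDef_aggSS F₁ hw hw1 O x hθk
  have h22 : (aggSS F₁ w O x θk).toBlocks₂₂.PosDef := hSS.submatrix Sum.inr_injective
  have h11 : (aggSS F₁ w O x θk).toBlocks₁₁.PosDef := hSS.submatrix Sum.inl_injective
  have hobj := fun (θ : Params n n₁ n₂) (hθ : θ.Feasible) =>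
    emObjective_eq_mObjective F₁ hw1 O x hθk hθ
  refine ⟨fun θ hθ => modelLaw_eq_withDensity F₁ hθ,
    fun τ => condDistrib_eq_condLaw F₁ hθk (O τ), fun τ => ?_,
    fun θ hθ τ => (integral_neg_two_mul_log_jointDensity F₁ hθk hθ _ _).1,
    ⟨_, fun θ hθ => hobj θ hθ⟩, h22, fun θ hθ => ?_, mStep_feasible_iff F₁ hw hw1 O x hθk,
    fun y C G L hC hG hL => agg_univ F₁ hθk hw1 y C G L hC hG hL⟩
  · have hX := memLp_merge_condLaw F₁ hθk (O τ) (x τ)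
    have hS := memLp_latent_condLaw F₁ hθk (O τ) (x τ)
    exact ⟨isProbabilityMeasure_condLaw F₁ hθk _ _, hθk.posDef_Gmat F₁ _,
      condLaw_map_snd F₁ hθk _ _, fun a b => (hS a).integrable_mul (hS b),
      fun i b => (hX i).integrable_mul (hS b), fun i j => (hX i).integrable_mul (hX j),
      condSS_eq F₁ hθk _ _, condXS_eq F₁ hθk _ _, condXX_eq F₁ hθk _ _⟩
  · refine Iff.trans ?_ (isMinOn_mObjective_iff h22 h11 hθ)
    refine forall₂_congr fun θ' (hθ' : θ'.Feasible) => ?_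
    simp only [Set.mem_ofPred_eq, hobj θ hθ, hobj θ' hθ', add_le_add_iff_right]
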